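/- Let $K$ be a finite lattice with a fixed planar diagram (straight edges that meet only at common endpoints), and for each $t\in K$ order the elements covered by $t$ from left to right. Suppose that $K$ is a slim patch lattice, that is: $K$ has no $\mathsf M_3$ sublattice; $K$ is semimodular; and the left-most dual atom $c_l$ and the right-most dual atom $c_r$ of $K$ are distinct and satisfy $c_l\wedge c_r=0$. A prime interval is an interval $\mathfrak p=[0_{\mathfrak p},1_{\mathfrak p}]$ with $0_{\mathfrak p}\prec 1_{\mathfrak p}$. We say that $\mathfrak p$ is *down-perspective* to $\mathfrak q$ if $1_{\mathfrak p}=0_{\mathfrak p}\vee 1_{\mathfrak q}$ and $0_{\mathfrak q}=0_{\mathfrak p}\wedge 1_{\mathfrak q}$; and that $\mathfrak p$ *swings* to $\mathfrak q$ if $1_{\mathfrak p}=1_{\mathfrak q}$, this element covers at least three elements, and $0_{\mathfrak q}$ is neither the left-most nor the right-most of them. Property (SL) says: for every prime interval $\mathfrak q$ with $1_{\mathfrak q}\le c_r$ there is a finite sequence of prime intervals $[c_l,1]=\mathfrak r_0,\mathfrak r_1,\dots,\mathfrak r_n=\mathfrak q$ such that, for each $i<n$, $\mathfrak r_i$ is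 down-perspective to or swings to $\mathfrak r_{i+1}$. Here $c_l$, $c_r$ are the left-most and right-most dual atoms of the lattice under consideration. Let $S=\{o,a_l,a_r,t\}$ be a covering square of $K$ (so $o\prec a_l\prec t$ and $o\prec a_r\prec t$), with $a_l$ to the left of $a_r$. The fork extension $K[S]$ is defined as follows. Put $x_{l,1}=a_l$, $y_{l,1}=o$; as long as there is a covering square with top $x_{l,i}$, with right corner $y_{l,i}$ and with left corner some $x'$ to the left of $y_{l,i}$, let $x_{l,i+1}=x'$ and let $y_{l,i+1}$ be the bottom of that square. Define $x_{r,i},y_{r,i}$ symmetrically, starting from $x_{r,1}=a_r$, $y_{r,1}=o$. Then $K[S]$ is $K$ together with new elements $m$, $z_{l,i}$, $z_{r,i}$ (one for each pair $(y_{l,i},x_{l,i})$, respectively $(y_{r,i},x_{r,i})$). The order of $K$ is kept; for $v\in K$ and $z$ the new element of the pair $(y,x)$, $v<z$ iff $v\le y$, and $z<v$ iff $x\le v$; $v<m$ iff $v\le o$, and $m<v$ iff $t\le v$; $z_{l,1}>z_{l,2}>\cdots$ and $z_{r,1}>z_{r,2}>\cdots$; all $z_{l,i},z_{r,i}$ are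 below $m$; and no $z_{l,i}$ is comparable with any $z_{r,j}$. In the diagram of $K[S]$, under an element of $K$, each $z_{l,i}$ (or $z_{r,i}$) takes the place of $y_{l,i}$ (or $y_{r,i}$) among the elements covered by $x_{l,i}$ (or $x_{r,i}$), and $m$ stands between $a_l$ and $a_r$ under $t$; $z_{l,i+1}$ is to the left of $y_{l,i}$ under $z_{l,i}$; $y_{r,i}$ is to the left of $z_{r,i+1}$ under $z_{r,i}$; $z_{l,1}$ is to the left of $z_{r,1}$ under $m$; otherwise the left-to-right order is that of $K$. If (SL) holds in $K$, then (SL) also holds in $K[S]$. -/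

import Mathlib

/-! ## Planar diagrams -/

/-- A planar (Hasse) diagram of a partially ordered set, with straight edges: the elements are
distinct points of the plane, larger elements are placed higher, and the segments drawn for the
coverings meet one another, and the points of the diagram, only at common endpoints. -/
structure PlanarDiagram (L : Type*) [PartialOrder L] where
  /-- the point of the plane (horizontal coordinate, vertical coordinate) of an element -/
  pos : L → ℝ × ℝ
  pos_injective : Function.Injective pos
  height_lt : ∀ a b : L, a < b → (pos a).2 < (pos b).2
  point_on_edge : ∀ a b v : L, a ⋖ b → pos v ∈ segment ℝ (pos a) (pos b) → v = a ∨ v = b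
  edge_inter_edge : ∀ a b c d : L, a ⋖ b → c ⋖ d → (a, b) ≠ (c, d) →
    ∀ P ∈ segment ℝ (pos a) (pos b) ∩ segment ℝ (pos c) (pos d),
      ∃ e : L, (e = a ∨ e = b) ∧ (e = c ∨ e = d) ∧ P = pos e

/-- `D.Left t a b`: both `a` and `b` are covered by `t`, and in the diagram `D` the edge from `t`
down to `a` leaves `t` to the left of the edge from `t` down to `b`
(one compares the horizontal displacements per unit of descent). -/
def PlanarDiagram.Left {L : Type*} [PartialOrder L] (D : PlanarDiagram L) (t a b : L) : Prop :=
  a ⋖ t ∧ b ⋖ t ∧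
    ((D.pos a).1 - (D.pos t).1) / ((D.pos t).2 - (D.pos a).2) <
      ((D.pos b).1 - (D.pos t).1) / ((D.pos t).2 - (D.pos b).2)

/-! ## Prime intervals, perspectivities, swings

In this part `left t a b` is the left-to-right order of the elements covered by `t`. -/

/-- A prime interval `[bot, top]`. -/
structure PrimeInterval (L : Type*) [PartialOrder L] where
  bot : L
  top : L
  covBy : bot ⋖ top

/-- `p` is down-perspective to `q`: `1_p = 0_p ∨ 1_q` and `0_q = 0_p ∧ 1_q`. -/
def PrimeInterval.DownPersp {L : Type*} [PartialOrder L] (p q : PrimeInterval L) : Prop :=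
  IsLUB {p.bot, q.top} p.top ∧ IsGLB {p.bot, q.top} q.bot

theorem PrimeInterval.downPersp_iff {L : Type*} [Lattice L] (p q : PrimeInterval L) :
    p.DownPersp q ↔ p.top = p.bot ⊔ q.top ∧ q.bot = p.bot ⊓ q.top :=
  ⟨fun h => ⟨h.1.unique isLUB_pair, h.2.unique isGLB_pair⟩,
    fun h => ⟨h.1 ▸ isLUB_pair, h.2 ▸ isGLB_pair⟩⟩

/-- `a` is the left-most element covered by `t`. -/
def IsLeftmost {L : Type*} [PartialOrder L] (left : L → L → L → Prop) (t a : L) : Prop :=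
  a ⋖ t ∧ ∀ b, b ⋖ t → b ≠ a → left t a b

/-- `a` is the right-most element covered by `t`. -/
def IsRightmost {L : Type*} [PartialOrder L] (left : L → L → L → Prop) (t a : L) : Prop :=
  a ⋖ t ∧ ∀ b, b ⋖ t → b ≠ a → left t b a

/-- `p` swings to `q`: `1_p = 1_q`, this element covers at least three elements, and `0_q` is
neither the left-most nor the right-most of them. -/
def PrimeInterval.Swings {L : Type*} [PartialOrder L] (left : L → L → L → Prop)
    (p q : PrimeInterval L) : Prop :=
  p.top = q.top ∧ 3 ≤ {a : L | a ⋖ p.top}.encard ∧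
    ¬ IsLeftmost left p.top q.bot ∧ ¬ IsRightmost left p.top q.bot

/-- Property (SL). Here `pl` and `pr` are the top left and the top right prime interval
`[c_l, 1]`, `[c_r, 1]`; a finite sequence of steps from `pl` to `q` is expressed by the reflexive
transitive closure. -/
def SL {L : Type*} [PartialOrder L] [OrderTop L] (left : L → L → L → Prop) : Prop :=
  ∃ pl pr : PrimeInterval L,
    pl.top = ⊤ ∧ IsLeftmost left ⊤ pl.bot ∧ pr.top = ⊤ ∧ IsRightmost left ⊤ pr.bot ∧
    ∀ q : PrimeInterval L, q.top ≤ pr.bot →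
      Relation.ReflTransGen (fun r s => r.DownPersp s ∨ r.Swings left s) pl q

/-! ## Slim patch lattices -/

/-- `L` contains no sublattice isomorphic to `M₃` (with bottom `z`, top `i`, atoms `u`, `v`, `w`). -/
def IsSlim (L : Type*) [Lattice L] : Prop :=
  ¬ ∃ z u v w i : L, u ≠ v ∧ v ≠ w ∧ u ≠ w ∧
    u ⊓ v = z ∧ v ⊓ w = z ∧ u ⊓ w = z ∧ u ⊔ v = i ∧ v ⊔ w = i ∧ u ⊔ w = i

/-- A finite lattice with planar diagram `D` is a slim patch lattice if it is slim, semimodular, and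
its left-most and right-most dual atoms are two distinct elements that meet in `0`. -/
structure IsSlimPatch {L : Type*} [Lattice L] [BoundedOrder L] (D : PlanarDiagram L) : Prop where
  finite : Finite L
  slim : IsSlim L
  semimodular : IsUpperModularLattice L
  patch : ∃ cl cr : L, IsLeftmost D.Left ⊤ cl ∧ IsRightmost D.Left ⊤ cr ∧ cl ≠ cr ∧ cl ⊓ cr = ⊥

/-! ## Fork extensions -/

/-- A covering square `{o, al, ar, t}`, with `al` to the left of `ar`. -/
structure CoveringSquare {L : Type*} [Lattice L] (D : PlanarDiagram L) where
  o : L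
  al : L
  ar : L
  t : L
  o_covBy_al : o ⋖ al
  o_covBy_ar : o ⋖ ar
  al_covBy_t : al ⋖ t
  ar_covBy_t : ar ⋖ t
  left : D.Left t al ar

namespace CoveringSquare

variable {L : Type*} [Lattice L] {D : PlanarDiagram L}

/-- `S.LeftEdge y x`: the prime interval `[y, x]` is one of `[y_{l,i}, x_{l,i}]`. One starts with
`[o, al]` and, as long as there is a covering square `{y', x', y, x}` with top `x` in which `x'` is
to the left of `y`, one passes from `[y, x]` to `[y', x']`, until the left boundary is reached. -/
inductive LeftEdge (S : CoveringSquare D) : L → L → Prop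
  | start : LeftEdge S S.o S.al
  | step (y x y' x' : L) : LeftEdge S y x → D.Left x x' y → y' ⋖ x' → y' ⋖ y → LeftEdge S y' x'

/-- `S.RightEdge y x`: the prime interval `[y, x]` is one of `[y_{r,i}, x_{r,i}]`. -/
inductive RightEdge (S : CoveringSquare D) : L → L → Prop
  | start : RightEdge S S.o S.ar
  | step (y x y' x' : L) : RightEdge S y x → D.Left x y x' → y' ⋖ x' → y' ⋖ y → RightEdge S y' x'

theorem inf_eq_of_square {x x' y y' o : L} (h : x ⊓ o = y) (hx : x' ⋖ x) (hy : y ⋖ x)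
    (hne : x' ≠ y) (h1 : y' ⋖ x') (h2 : y' ⋖ y) : x' ⊓ o = y' := by
  have e : x' ⊓ o = x' ⊓ y := by
    rw [← h, ← inf_assoc, inf_eq_left.2 hx.le]
  rw [e]
  rcases h1.eq_or_eq (le_inf h1.le h2.le) inf_le_left with h3 | h3
  · exact h3
  · exfalso
    rcases hx.eq_or_eq (inf_eq_left.1 h3) hy.le with h4 | h4
    · exact hne h4.symm
    · exact hy.ne h4

theorem LeftEdge.spec {S : CoveringSquare D} {y x : L} (h : S.LeftEdge y x) :
    y ⋖ x ∧ x ≤ S.al ∧ x ⊓ S.o = y := by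
  induction h with
  | start => exact ⟨S.o_covBy_al, le_rfl, inf_eq_right.2 S.o_covBy_al.le⟩
  | step y x y' x' _ hl h1 h2 ih =>
    exact ⟨h1, hl.1.le.trans ih.2.1,
      inf_eq_of_square ih.2.2 hl.1 ih.1 (fun e => absurd hl.2.2 (by rw [e]; exact lt_irrefl _)) h1 h2⟩

theorem RightEdge.spec {S : CoveringSquare D} {y x : L} (h : S.RightEdge y x) :
    y ⋖ x ∧ x ≤ S.ar ∧ x ⊓ S.o = y := by
  induction h with
  | start => exact ⟨S.o_covBy_ar, le_rfl, inf_eq_right.2 S.o_covBy_ar.le⟩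
  | step y x y' x' _ hl h1 h2 ih =>
    exact ⟨h1, hl.2.1.le.trans ih.2.1,
      inf_eq_of_square ih.2.2 hl.2.1 ih.1 (fun e => absurd hl.2.2 (by rw [e]; exact lt_irrefl _))
        h1 h2⟩

/-- The underlying set of the fork extension `K[S]`: the elements of the lattice, the element `m`,
one new element `z_{l,i}` for each prime interval `[y_{l,i}, x_{l,i}]`, and one new element
`z_{r,i}` for each prime interval `[y_{r,i}, x_{r,i}]`. -/
inductive Fork (S : CoveringSquare D)
  | old (v : L)
  | m
  | zl (y x : L) (h : S.LeftEdge y x)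
  | zr (y x : L) (h : S.RightEdge y x)

namespace Fork

variable {S : CoveringSquare D}

/-- The order of `K[S]`: the new element of `[y, x]` lies between `y` and `x`, the element `m` lies
between `o` and `t`, and `z_{l,1} > z_{l,2} > ⋯` and `z_{r,1} > z_{r,2} > ⋯` are chains
below `m`. -/
protected def le : Fork S → Fork S → Prop
  | old u, old v => u ≤ v
  | old u, m => u ≤ S.o
  | old u, zl y _ _ => u ≤ y
  | old u, zr y _ _ => u ≤ y
  | m, old v => S.t ≤ v
  | m, m => True
  | m, zl _ _ _ => False
  | m, zr _ _ _ => False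
  | zl _ x _, old v => x ≤ v
  | zl _ _ _, m => True
  | zl y x _, zl y' x' _ => y ≤ y' ∧ x ≤ x'
  | zl _ _ _, zr _ _ _ => False
  | zr _ x _, old v => x ≤ v
  | zr _ _ _, m => True
  | zr _ _ _, zl _ _ _ => False
  | zr y x _, zr y' x' _ => y ≤ y' ∧ x ≤ x'

instance : LE (Fork S) := ⟨Fork.le⟩

instance : PartialOrder (Fork S) where
  le_refl a := by
    change Fork.le a a
    cases a <;> simp [Fork.le]
  le_trans a b c hab hbc := by
    change Fork.le a b at hab
    change Fork.le b c at hbc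
    change Fork.le a c
    have ot : ¬ S.t ≤ S.o := fun h =>
      (S.o_covBy_al.lt.trans S.al_covBy_t.lt).not_ge h
    have ot' : S.o ≤ S.t := S.o_covBy_al.le.trans S.al_covBy_t.le
    have hl : ∀ {y x : L}, S.LeftEdge y x → y ≤ x ∧ y ≤ S.o ∧ x ≤ S.t ∧ ¬ x ≤ S.o := by
      intro y x h
      obtain ⟨h1, h2, h3⟩ := h.spec
      exact ⟨h1.le, h3 ▸ inf_le_right, h2.trans S.al_covBy_t.le,
        fun h4 => h1.ne' ((inf_eq_left.2 h4).symm.trans h3)⟩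
    have hr : ∀ {y x : L}, S.RightEdge y x → y ≤ x ∧ y ≤ S.o ∧ x ≤ S.t ∧ ¬ x ≤ S.o := by
      intro y x h
      obtain ⟨h1, h2, h3⟩ := h.spec
      exact ⟨h1.le, h3 ▸ inf_le_right, h2.trans S.ar_covBy_t.le,
        fun h4 => h1.ne' ((inf_eq_left.2 h4).symm.trans h3)⟩
    rcases a with u | _ | ⟨y, x, ha⟩ | ⟨y, x, ha⟩ <;>
    rcases b with v | _ | ⟨y', x', hb⟩ | ⟨y', x', hb⟩ <;>
    rcases c with w | _ | ⟨y'', x'', hc⟩ | ⟨y'', x'', hc⟩ <;>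
    simp only [Fork.le] at hab hbc ⊢ <;>
    grind
  le_antisymm a b hab hba := by
    change Fork.le a b at hab
    change Fork.le b a at hba
    have ot : ¬ S.t ≤ S.o := fun h =>
      (S.o_covBy_al.lt.trans S.al_covBy_t.lt).not_ge h
    have hl : ∀ {y x : L}, S.LeftEdge y x → ¬ x ≤ y := fun h h' => h.spec.1.lt.not_ge h'
    have hr : ∀ {y x : L}, S.RightEdge y x → ¬ x ≤ y := fun h h' => h.spec.1.lt.not_ge h'
    rcases a with u | _ | ⟨y, x, ha⟩ | ⟨y, x, ha⟩ <;>
    rcases b with v | _ | ⟨y', x', hb⟩ | ⟨y', x', hb⟩ <;>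
    simp only [Fork.le] at hab hba <;>
    grind

instance [OrderTop L] : OrderTop (Fork S) where
  top := old ⊤
  le_top a := by
    change Fork.le a (old ⊤)
    cases a <;> simp [Fork.le]

/-- The left-to-right position, in the diagram of `K[S]`, of two elements hanging from the same
element (first argument). Under an old element `w`, the new element of `[y, w]` takes the place
of `y`, and under `t` the element `m` stands between `al` and `ar`;
`z_{l,i}` covers `z_{l,i+1}` on the left and `y_{l,i}` on the right, symmetrically for `z_{r,i}`,
and `m` covers `z_{l,1}` on the left and `z_{r,1}` on the right. -/
def Before : Fork S → Fork S → Fork S → Prop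
  | old w, old u, old v => D.Left w u v
  | old w, old u, m => D.Left w u S.ar
  | old w, m, old v => D.Left w S.al v
  | old w, old u, zl y _ _ => D.Left w u y
  | old w, old u, zr y _ _ => D.Left w u y
  | old w, zl y _ _, old v => D.Left w y v
  | old w, zr y _ _, old v => D.Left w y v
  | zl _ _ _, zl _ _ _, old _ => True
  | zr _ _ _, old _, zr _ _ _ => True
  | m, zl _ _ _, zr _ _ _ => True
  | _, _, _ => False

/-- `Fork.Left t a b`: in the diagram of `K[S]`, the elements `a` and `b` are covered by `t`, and
`a` is to the left of `b`. -/
def Left (t a b : Fork S) : Prop :=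
  a ⋖ t ∧ b ⋖ t ∧ Before t a b

end Fork

end CoveringSquare

/-! The fork subdivides exactly the prime intervals `[y, x]` that are left or right edges of `S`;
every other prime interval of K stays prime in K[S]. A step sequence in K is carried over by an
invariant, `Transfers`: an interval that is not an edge is itself reached in K[S], while for a left
edge it is `[ar, t]` that is reached, and for a right edge `[al, t]`. This suffices for both halves
of a left edge: `[ar, t]` is down-perspective to `[y, z]`, and it swings to `[m, t]`, which is
down-perspective to `[z, x]`.

The invariant survives each step for three reasons. A swing never ends in an edge, because the
bottom of a left edge is the right-most element covered by its top, and symmetrically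
(`LeftEdge.isRightmost`). A down-perspectivity that starts at a left edge ends at a left edge
(`LeftEdge.of_perspective`). One that enters a left edge from an interval that is not a left edge
comes from an interval that is also down-perspective to `[ar, t]` (`LeftEdge.of_perspective_up`).
All prime intervals of K[S] below `c_r` are then obtained from old ones in at most two further
steps.

These facts about edges rest on planarity and slimness: a common lower bound of two elements covered
by x lies below everything between them (`Left.le_of_le_of_le`), and an element has at most two
upper covers (`IsSlim.eq_or_eq_of_covBy`). Planarity enters through the intermediate value theorem,
applied to maximal chains drawn as graphs over the height. -/

namespace PlanarDiagram

open Set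

/-! ### Chains of a planar diagram as curves over the height -/

section Curves

variable {L : Type*} [PartialOrder L] (D : PlanarDiagram L)

/-- The horizontal displacement per unit of descent of the edge from `t` down to `a`. -/
noncomputable def slope (t a : L) : ℝ :=
  ((D.pos a).1 - (D.pos t).1) / ((D.pos t).2 - (D.pos a).2)

theorem left_iff {t a b : L} : D.Left t a b ↔ a ⋖ t ∧ b ⋖ t ∧ D.slope t a < D.slope t b := Iff.rfl

/-- The straight line through `t` and `a`, as a function of the height. -/
noncomputable def line (t a : L) (s : ℝ) : ℝ :=
  (D.pos t).1 + D.slope t a * ((D.pos t).2 - s)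

theorem line_top (t a : L) : D.line t a (D.pos t).2 = (D.pos t).1 := by simp [line]

theorem line_bot {t a : L} (h : a < t) : D.line t a (D.pos a).2 = (D.pos a).1 := by
  have := sub_pos.2 (D.height_lt a t h)
  unfold line slope
  field_simp
  ring

theorem line_lt_line {t a b : L} (h : D.Left t a b) {s : ℝ} (hs : s < (D.pos t).2) :
    D.line t a s < D.line t b s := by
  have h1 := (D.left_iff.1 h).2.2
  have := mul_lt_mul_of_pos_right h1 (sub_pos.2 hs)
  unfold line
  linarith

theorem line_mem_segment {t a : L} (h : a < t) {s : ℝ} (hs : s ∈ Icc (D.pos a).2 (D.pos t).2) :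
    (D.line t a s, s) ∈ segment ℝ (D.pos a) (D.pos t) := by
  have h0 := sub_pos.2 (D.height_lt a t h)
  have h0' := h0.ne'
  refine ⟨((D.pos t).2 - s) / ((D.pos t).2 - (D.pos a).2),
    (s - (D.pos a).2) / ((D.pos t).2 - (D.pos a).2),
    div_nonneg (sub_nonneg.2 hs.2) h0.le, div_nonneg (sub_nonneg.2 hs.1) h0.le, ?_, ?_⟩
  · field_simp
    ring
  · ext
    · simp only [Prod.fst_add, Prod.smul_fst, smul_eq_mul, line, slope]
      field_simp
      ring
    · simp only [Prod.snd_add, Prod.smul_snd, smul_eq_mul]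
      field_simp
      ring

theorem height_le {a b : L} (h : a ≤ b) : (D.pos a).2 ≤ (D.pos b).2 := by
  rcases h.eq_or_lt with rfl | h
  · exact le_rfl
  · exact (D.height_lt _ _ h).le

/-- Two edges leaving `t` in the same direction overlap, so the lower end of the shorter one would
be a point of the longer one. -/
theorem slope_ne {t a b : L} (ha : a ⋖ t) (hb : b ⋖ t) (hab : a ≠ b) :
    D.slope t a ≠ D.slope t b := by
  intro h
  wlog hle : (D.pos a).2 ≤ (D.pos b).2 generalizing a b
  · exact this hb ha hab.symm h.symm (le_of_not_ge hle)
  have h1 : (D.line t a (D.pos b).2, (D.pos b).2) ∈ segment ℝ (D.pos a) (D.pos t) :=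
    D.line_mem_segment ha.lt ⟨hle, D.height_le hb.le⟩
  have h2 : D.line t a (D.pos b).2 = (D.pos b).1 := by
    rw [← D.line_bot hb.lt]
    simp [line, h]
  rw [h2] at h1
  rcases D.point_on_edge a t b ha h1 with h3 | h3
  · exact hab h3.symm
  · exact hb.ne h3

theorem left_total {t a b : L} (ha : a ⋖ t) (hb : b ⋖ t) (hab : a ≠ b) :
    D.Left t a b ∨ D.Left t b a :=
  (lt_or_gt_of_ne (D.slope_ne ha hb hab)).imp (fun h => ⟨ha, hb, h⟩) (fun h => ⟨hb, ha, h⟩)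

variable {D}

theorem Left.asymm {t a b : L} (h : D.Left t a b) : ¬ D.Left t b a :=
  fun h' => lt_asymm h.2.2 h'.2.2

theorem Left.ne {t a b : L} (h : D.Left t a b) : a ≠ b := by
  rintro rfl
  exact lt_irrefl _ h.2.2

theorem Left.trans {t a b c : L} (h : D.Left t a b) (h' : D.Left t b c) : D.Left t a c :=
  ⟨h.1, h'.2.1, lt_trans h.2.2 h'.2.2⟩

variable (D)

/-- The graph of `f`, a function of the height, is a curve from `p` up to `q` that runs along edges
of the diagram with endpoints in `V`. -/
structure IsCurve (V : Set L) (f : ℝ → ℝ) (p q : L) : Prop where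
  continuousOn : ContinuousOn f (Icc (D.pos p).2 (D.pos q).2)
  mem_edge : ∀ s ∈ Icc (D.pos p).2 (D.pos q).2, ∃ u ∈ V, ∃ v ∈ V, u ⩿ v ∧
    (f s, s) ∈ segment ℝ (D.pos u) (D.pos v)
  map_bot : f (D.pos p).2 = (D.pos p).1
  map_top : f (D.pos q).2 = (D.pos q).1

variable {D}

theorem IsCurve.mono {V W : Set L} {f : ℝ → ℝ} {p q : L} (h : D.IsCurve V f p q) (hVW : V ⊆ W) :
    D.IsCurve W f p q where
  continuousOn := h.continuousOn
  mem_edge s hs := by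
    obtain ⟨u, hu, v, hv, h'⟩ := h.mem_edge s hs
    exact ⟨u, hVW hu, v, hVW hv, h'⟩
  map_bot := h.map_bot
  map_top := h.map_top

theorem isCurve_line {a t : L} (h : a ⋖ t) : D.IsCurve {a, t} (D.line t a) a t where
  continuousOn := by unfold line; fun_prop
  mem_edge s hs := ⟨a, by simp, t, by simp, h.wcovBy, D.line_mem_segment h.lt hs⟩
  map_bot := D.line_bot h.lt
  map_top := D.line_top t a

theorem IsCurve.append {V W : Set L} {f g : ℝ → ℝ} {p q r : L} (hf : D.IsCurve V f p q)
    (hg : D.IsCurve W g q r) (hpq : p ≤ q) (hqr : q ≤ r) :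
    D.IsCurve (V ∪ W) (fun s => if s ≤ (D.pos q).2 then f s else g s) p r where
  continuousOn := by
    have h1 := D.height_le hpq
    have h2 := D.height_le hqr
    rw [← Icc_union_Icc_eq_Icc h1 h2]
    refine ContinuousOn.union_of_isClosed ?_ ?_ isClosed_Icc isClosed_Icc
    · exact hf.continuousOn.congr fun s hs => if_pos hs.2
    · refine hg.continuousOn.congr fun s hs => ?_
      rcases hs.1.eq_or_lt with h | h
      · simp [← h, hf.map_top, hg.map_bot]
      · exact if_neg h.not_ge
  mem_edge s hs := by
    by_cases h : s ≤ (D.pos q).2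
    · obtain ⟨u, hu, v, hv, h'⟩ := hf.mem_edge s ⟨hs.1, h⟩
      exact ⟨u, .inl hu, v, .inl hv, by simpa [h] using h'⟩
    · obtain ⟨u, hu, v, hv, h'⟩ := hg.mem_edge s ⟨(not_le.1 h).le, hs.2⟩
      exact ⟨u, .inr hu, v, .inr hv, by simpa [h] using h'⟩
  map_bot := by simp [D.height_le hpq, hf.map_bot]
  map_top := by
    rcases (D.height_le hqr).eq_or_lt with h | h
    · have h1 := hf.map_top
      have h2 := hg.map_bot
      rw [h] at h1 h2
      simp [h, h1, ← h2, hg.map_top]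
    · simp [h, hg.map_top]

theorem exists_isCurve [Finite L] {p q : L} (h : p ≤ q) : ∃ f, D.IsCurve (Icc p q) f p q := by
  induction q using WellFoundedLT.induction with
  | ind q ih =>
    rcases h.eq_or_lt with rfl | h
    -- A curve reduced to one point runs along the degenerate edge from `p` to `p`; this is why
    -- `IsCurve` asks only for `⩿`.
    · refine ⟨fun _ => (D.pos p).1, continuousOn_const, fun s hs => ?_, rfl, rfl⟩
      refine ⟨p, by simp, p, by simp, WCovBy.refl p, ?_⟩
      have : s = (D.pos p).2 := le_antisymm hs.2 hs.1
      simp [this]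
    · obtain ⟨r, hpr, hrq⟩ := exists_le_covBy_of_lt h
      obtain ⟨f, hf⟩ := ih r hrq.lt hpr
      refine ⟨_, (hf.append (isCurve_line hrq) hpr hrq.le).mono ?_⟩
      rintro x (hx | rfl | rfl)
      · exact ⟨hx.1, hx.2.trans hrq.le⟩
      · exact ⟨hpr, hrq.le⟩
      · exact ⟨h.le, le_rfl⟩

/-- The prescribed last edge lets curves that end at the same `t` be compared just below `t` by
their slopes; apart from `t`, every vertex available to the curve lies in `[p, a]`. -/
theorem exists_isCurve_append_edge [Finite L] {p a t : L} (h : p ≤ a) (ha : a ⋖ t) :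
    ∃ f, D.IsCurve (insert t (Icc p a)) f p t ∧
      ∀ s, (D.pos a).2 ≤ s → f s = D.line t a s := by
  obtain ⟨f, hf⟩ := D.exists_isCurve h
  refine ⟨_, (hf.append (isCurve_line ha) h ha.le).mono ?_, fun s hs => ?_⟩
  · rintro x (hx | rfl | rfl)
    · exact .inr hx
    · exact .inr ⟨h, le_rfl⟩
    · exact .inl rfl
  · rcases hs.eq_or_lt with hs | hs
    · simp [← hs, hf.map_top, D.line_bot ha.lt]
    · simp [hs]

theorem exists_mem_of_wcovBy_inter {V W : Set L} {u v a b : L} {P : ℝ × ℝ} (hu : u ∈ V)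
    (hv : v ∈ V) (ha : a ∈ W) (hb : b ∈ W) (huv : u ⩿ v) (hab : a ⩿ b)
    (hP : P ∈ segment ℝ (D.pos u) (D.pos v)) (hP' : P ∈ segment ℝ (D.pos a) (D.pos b)) :
    (∃ e ∈ V ∩ W, P = D.pos e) ∨ (u = a ∧ v = b) := by
  rcases huv.covBy_or_eq with huv | rfl
  · rcases hab.covBy_or_eq with hab | rfl
    · by_cases h : (u, v) = (a, b)
      · exact .inr (Prod.mk.injEq .. ▸ h)
      · obtain ⟨e, he, he', hPe⟩ := D.edge_inter_edge u v a b huv hab h P ⟨hP, hP'⟩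
        exact .inl ⟨e, ⟨by rcases he with rfl | rfl <;> assumption,
          by rcases he' with rfl | rfl <;> assumption⟩, hPe⟩
    · rw [segment_same, mem_singleton_iff] at hP'
      subst hP'
      refine .inl ⟨a, ⟨?_, ha⟩, rfl⟩
      rcases D.point_on_edge u v a huv hP with rfl | rfl <;> assumption
  · rw [segment_same, mem_singleton_iff] at hP
    subst hP
    refine .inl ⟨u, ⟨hu, ?_⟩, rfl⟩
    rcases hab.covBy_or_eq with hab | rfl
    · rcases D.point_on_edge a b u hab hP' with rfl | rfl <;> assumption
    · rw [segment_same, mem_singleton_iff] at hP'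
      rwa [D.pos_injective hP']

theorem snd_mem_of_mem_segment {u v : L} (huv : u ≤ v) {P : ℝ × ℝ}
    (hP : P ∈ segment ℝ (D.pos u) (D.pos v)) : P.2 ∈ Icc (D.pos u).2 (D.pos v).2 := by
  rw [← segment_eq_Icc (D.height_le huv)]
  obtain ⟨x, y, hx, hy, hxy, rfl⟩ := hP
  exact ⟨x, y, hx, hy, hxy, by simp⟩

/-- Two curves that change sides meet at a common vertex, or share an edge. -/
theorem IsCurve.exists_common {V W : Set L} {f g : ℝ → ℝ} {p q p' q' : L}
    (hf : D.IsCurve V f p q) (hg : D.IsCurve W g p' q') {s s' : ℝ}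
    (hs : s ∈ Icc (D.pos p).2 (D.pos q).2) (hs' : s' ∈ Icc (D.pos p).2 (D.pos q).2)
    (ht : s ∈ Icc (D.pos p').2 (D.pos q').2) (ht' : s' ∈ Icc (D.pos p').2 (D.pos q').2)
    (h : f s ≤ g s) (h' : g s' ≤ f s') :
    ∃ u ∈ V ∩ W, ∃ v ∈ V ∩ W, u ⩿ v ∧ (D.pos u).2 ≤ max s s' ∧ min s s' ≤ (D.pos v).2 := by
  have h1 : uIcc s s' ⊆ Icc (D.pos p).2 (D.pos q).2 := ordConnected_Icc.uIcc_subset hs hs'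
  have h2 : uIcc s s' ⊆ Icc (D.pos p').2 (D.pos q').2 := ordConnected_Icc.uIcc_subset ht ht'
  -- At the height `r` the two curves meet. The point is a common vertex, or it lies on an edge used
  -- by both, and then both endpoints are needed to locate it.
  obtain ⟨r, hr, hfg⟩ := isPreconnected_uIcc.intermediate_value₂ left_mem_uIcc right_mem_uIcc
    (hf.continuousOn.mono h1) (hg.continuousOn.mono h2) h h'
  obtain ⟨u, hu, v, hv, huv, hP⟩ := hf.mem_edge r (h1 hr)
  obtain ⟨a, ha, b, hb, hab, hP'⟩ := hg.mem_edge r (h2 hr)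
  rw [← hfg] at hP'
  rcases D.exists_mem_of_wcovBy_inter hu hv ha hb huv hab hP hP' with ⟨e, he, hPe⟩ | ⟨rfl, rfl⟩
  · have : (D.pos e).2 = r := by rw [← hPe]
    exact ⟨e, he, e, he, WCovBy.refl e, this ▸ hr.2, this ▸ hr.1⟩
  · have := snd_mem_of_mem_segment huv.le hP
    exact ⟨u, ⟨hu, ha⟩, v, ⟨hv, hb⟩, huv, this.1.trans hr.2, hr.1.trans this.2⟩

variable (D)

/-- The diagram reflected in a vertical line. -/
def mirror : PlanarDiagram L where
  pos a := (-(D.pos a).1, (D.pos a).2)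
  pos_injective a b h := by
    simp only [Prod.mk.injEq, neg_inj] at h
    exact D.pos_injective (Prod.ext h.1 h.2)
  height_lt := D.height_lt
  point_on_edge a b v hab := by
    rintro ⟨x, y, hx, hy, hxy, h⟩
    refine D.point_on_edge a b v hab ⟨x, y, hx, hy, hxy, ?_⟩
    simp only [Prod.ext_iff, Prod.fst_add, Prod.snd_add, Prod.smul_fst, Prod.smul_snd,
      smul_eq_mul] at h ⊢
    constructor <;> linarith
  edge_inter_edge a b c d hab hcd hne := by
    have key {u v : L} {P : ℝ × ℝ} (h : P ∈ segment ℝ (-(D.pos u).1, (D.pos u).2)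
        (-(D.pos v).1, (D.pos v).2)) : (-P.1, P.2) ∈ segment ℝ (D.pos u) (D.pos v) := by
      obtain ⟨x, y, hx, hy, hxy, h⟩ := h
      refine ⟨x, y, hx, hy, hxy, ?_⟩
      simp only [Prod.ext_iff, Prod.fst_add, Prod.snd_add, Prod.smul_fst, Prod.smul_snd,
        smul_eq_mul] at h ⊢
      constructor <;> linarith
    intro P hP
    obtain ⟨e, he, he', hPe⟩ := D.edge_inter_edge a b c d hab hcd hne (-P.1, P.2)
      ⟨key hP.1, key hP.2⟩
    refine ⟨e, he, he', ?_⟩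
    simp only [Prod.ext_iff] at hPe ⊢
    constructor <;> linarith

theorem mirror_left {t a b : L} : D.mirror.Left t a b ↔ D.Left t b a := by
  have h (c : L) : D.mirror.slope t c = -D.slope t c := by
    change (-(D.pos c).1 - -(D.pos t).1) / _ = -(((D.pos c).1 - (D.pos t).1) / _)
    rw [← neg_div]
    congr 1
    ring
  rw [left_iff, left_iff, h, h, neg_lt_neg_iff]
  tauto

/-- The diagram of the dual order, turned upside down. -/
def dual : PlanarDiagram Lᵒᵈ where
  pos a := ((D.pos (OrderDual.ofDual a)).1, -(D.pos (OrderDual.ofDual a)).2)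
  pos_injective a b h := by
    simp only [Prod.mk.injEq, neg_inj] at h
    exact D.pos_injective (Prod.ext h.1 h.2)
  height_lt a b h := neg_lt_neg (D.height_lt _ _ h)
  point_on_edge a b v hab := by
    rintro ⟨x, y, hx, hy, hxy, h⟩
    refine (D.point_on_edge _ _ v hab.ofDual ⟨y, x, hy, hx, by linarith, ?_⟩).symm
    simp only [Prod.ext_iff, Prod.fst_add, Prod.snd_add, Prod.smul_fst, Prod.smul_snd,
      smul_eq_mul] at h ⊢
    constructor <;> linarith!
  edge_inter_edge a b c d hab hcd hne := by
    have key {u v : L} {P : ℝ × ℝ} (h : P ∈ segment ℝ ((D.pos u).1, -(D.pos u).2)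
        ((D.pos v).1, -(D.pos v).2)) : (P.1, -P.2) ∈ segment ℝ (D.pos v) (D.pos u) := by
      obtain ⟨x, y, hx, hy, hxy, h⟩ := h
      refine ⟨y, x, hy, hx, by linarith, ?_⟩
      simp only [Prod.ext_iff, Prod.fst_add, Prod.snd_add, Prod.smul_fst, Prod.smul_snd,
        smul_eq_mul] at h ⊢
      constructor <;> linarith
    intro P hP
    obtain ⟨e, he, he', hPe⟩ := D.edge_inter_edge _ _ _ _ hab.ofDual hcd.ofDual
      (by simp only [ne_eq, Prod.mk.injEq] at hne ⊢; exact fun h => hne ⟨h.2, h.1⟩) (P.1, -P.2)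
      ⟨key hP.1, key hP.2⟩
    refine ⟨e, he.symm, he'.symm, ?_⟩
    simp only [Prod.ext_iff] at hPe ⊢
    exact ⟨hPe.1, (neg_eq_iff_eq_neg.1 hPe.2)⟩

end Curves

end PlanarDiagram

namespace PlanarDiagram

open Set

/-! ### Lower covers from left to right -/

section Planarity

variable {L : Type*} [PartialOrder L] [Finite L] {D : PlanarDiagram L}

/-- The curves from `w` to `x` through `a` and through `c` enclose `b`. A chain from `⊥` through `b`
has to enter this region, and it can do so only at a vertex above `w`. -/
theorem Left.le_of_le_of_le [OrderBot L] {x a b c w : L} (hab : D.Left x a b) (hbc : D.Left x b c)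
    (ha : w ≤ a) (hc : w ≤ c) : w ≤ b := by
  by_contra hw
  obtain ⟨f, hf, hf'⟩ := D.exists_isCurve_append_edge ha hab.1
  obtain ⟨k, hk, hk'⟩ := D.exists_isCurve_append_edge (bot_le (a := b)) hab.2.1
  obtain ⟨g, hg, hg'⟩ := D.exists_isCurve_append_edge hc hbc.2.1
  have hwx := D.height_lt w x (ha.trans_lt hab.1.lt)
  -- At the height `s` all three curves are already on their last edges.
  obtain ⟨s, hs, hsx⟩ : ∃ s, ((D.pos w).2 ≤ s ∧ (D.pos a).2 ≤ s ∧ (D.pos b).2 ≤ s ∧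
      (D.pos c).2 ≤ s) ∧ s < (D.pos x).2 :=
    ⟨max (D.pos w).2 (max (D.pos a).2 (max (D.pos b).2 (D.pos c).2)), by simp, by
      simp [hwx, D.height_lt _ _ hab.1.lt, D.height_lt _ _ hab.2.1.lt,
        D.height_lt _ _ hbc.2.1.lt]⟩
  have hbw := D.height_le (bot_le (a := w))
  have key {d : L} (hd : d ⋖ x) (hne : d ≠ b) (h : ∃ u ∈ insert x (Icc w d) ∩ insert x (Icc ⊥ b),
      (D.pos u).2 ≤ s) : False := by
    obtain ⟨u, ⟨hu | hu, hu'⟩, hus⟩ := h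
    · exact (hus.trans_lt hsx).ne (by rw [hu])
    · rcases hu' with hu' | hu'
      · exact (hus.trans_lt hsx).ne (by rw [hu'])
      · exact hw (hu.1.trans hu'.2)
  have I1 : (D.pos w).2 ∈ Icc (D.pos w).2 (D.pos x).2 := ⟨le_rfl, hwx.le⟩
  have I2 : s ∈ Icc (D.pos w).2 (D.pos x).2 := ⟨hs.1, hsx.le⟩
  have I3 : (D.pos w).2 ∈ Icc (D.pos (⊥ : L)).2 (D.pos x).2 := ⟨hbw, hwx.le⟩
  have I4 : s ∈ Icc (D.pos (⊥ : L)).2 (D.pos x).2 := ⟨hbw.trans hs.1, hsx.le⟩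
  -- If `k` passes `w` on the left it must cross `f` before `x`; if on the right, it must cross `g`.
  rcases le_total (k (D.pos w).2) (D.pos w).1 with h | h
  · obtain ⟨u, hu, -, -, -, hus, -⟩ := hf.exists_common hk I2 I1 I4 I3
      (by rw [hf' s hs.2.1, hk' s hs.2.2.1]; exact (D.line_lt_line hab hsx).le)
      (by rwa [hf.map_bot])
    exact key hab.1 hab.ne ⟨u, hu, hus.trans_eq (max_eq_left hs.1)⟩
  · obtain ⟨u, hu, -, -, -, hus, -⟩ := hg.exists_common hk I1 I2 I3 I4
      (by rwa [hg.map_bot])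
      (by rw [hg' s hs.2.2.2, hk' s hs.2.2.1]; exact (D.line_lt_line hbc hsx).le)
    exact key hbc.2.1 hbc.ne.symm ⟨u, hu, hus.trans_eq (max_eq_right hs.1)⟩

/-- In a covering square with top `x`, left corner `x'`, right corner `y` and bottom `y'`, the
bottom is the right-most element covered by the left corner. -/
theorem Left.isRightmost_of_square [OrderBot L] {x x' y y' : L} (h : D.Left x x' y) (h1 : y' ⋖ x')
    (h2 : y' ⋖ y) : IsRightmost D.Left x' y' := by
  refine ⟨h1, fun e he hne => (D.left_total he h1 hne).resolve_right fun hl => ?_⟩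
  obtain ⟨f, hf, hf'⟩ := D.exists_isCurve_append_edge h1.le h.1
  obtain ⟨g, hg, hg'⟩ := D.exists_isCurve_append_edge h2.le h.2.1
  obtain ⟨k, hk, hk'⟩ := D.exists_isCurve_append_edge (bot_le (a := e)) he
  have l1 := D.height_lt _ _ h1.lt
  have l2 := D.height_lt _ _ h.1.lt
  have l3 := D.height_lt _ _ h2.lt
  have l4 := D.height_lt _ _ h.2.1.lt
  have l5 := D.height_lt _ _ he.lt
  have lb := D.height_le (bot_le (a := y'))
  have hye : ¬ y' ≤ e := fun h' => by
    rcases h1.eq_or_eq h' he.le with h3 | h3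
    · exact hne h3
    · exact he.ne h3
  have hx'y : ¬ x' ≤ y := fun h' => by
    rcases h.1.eq_or_eq h' h.2.1.le with h3 | h3
    · exact h.ne h3.symm
    · exact h.2.1.ne h3
  -- the curve through `x'` stays to the left of the one through `y` at the height of `x'`
  have hfg : f (D.pos x').2 < g (D.pos x').2 := by
    by_contra! hgf
    obtain ⟨s, hs, hsx⟩ : ∃ s, ((D.pos x').2 ≤ s ∧ (D.pos y).2 ≤ s) ∧ s < (D.pos x).2 :=
      ⟨max (D.pos x').2 (D.pos y).2, by simp, by simp [l2, l4]⟩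
    obtain ⟨u, hu, v, hv, huv, hus, hvs⟩ := hf.exists_common hg (s := s) (s' := (D.pos x').2)
      ⟨l1.le.trans hs.1, hsx.le⟩ ⟨l1.le, l2.le⟩ ⟨l1.le.trans hs.1, hsx.le⟩ ⟨l1.le, l2.le⟩
      (by rw [hf' s hs.1, hg' s hs.2]; exact (D.line_lt_line h hsx).le) hgf
    rw [max_eq_left hs.1] at hus
    rw [min_eq_right hs.1] at hvs
    have key {z : L} (hz : z ∈ insert x (Icc y' x') ∩ insert x (Icc y' y)) : z = x ∨ z = y' := by
      rcases hz.1 with hz1 | hz1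
      · exact .inl hz1
      · rcases hz.2 with hz2 | hz2
        · exact .inl hz2
        · rcases h1.eq_or_eq hz1.1 hz1.2 with h3 | h3
          · exact .inr h3
          · exact absurd (h3 ▸ hz2.2) hx'y
    -- The only common vertices are `x` and `y'`, and neither lies in the range of heights
    -- considered; a shared edge from `y'` to `x` is excluded by `x'`.
    rcases key hu with rfl | rfl
    · exact absurd hsx hus.not_gt
    · rcases key hv with rfl | rfl
      · exact huv.2 h1.lt h.1.lt
      · exact absurd l1 hvs.not_gt
  obtain ⟨s, hs, hsx⟩ : ∃ s, ((D.pos y').2 ≤ s ∧ (D.pos e).2 ≤ s) ∧ s < (D.pos x').2 :=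
    ⟨max (D.pos y').2 (D.pos e).2, by simp, by simp [l1, l5]⟩
  have hkx : k (D.pos x').2 = f (D.pos x').2 := by
    rw [hk.map_top, hf' _ le_rfl, D.line_bot h.1.lt]
  -- If `e` were to the right of `y'`, a chain down from `x'` through `e` would start inside the
  -- square; leaving it, the chain would cross the edge from `y'` to `x'` or the curve `g`, at a
  -- vertex above `y'`, giving `y' ≤ e`.
  rcases le_total (k (D.pos y').2) (D.pos y').1 with h0 | h0
  · obtain ⟨u, hu, -, -, -, hus, -⟩ := (isCurve_line h1).exists_common hk (s := s)
      (s' := (D.pos y').2) ⟨hs.1, hsx.le⟩ ⟨le_rfl, l1.le⟩ ⟨lb.trans hs.1, hsx.le⟩ ⟨lb, l1.le⟩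
      (by rw [hk' s hs.2]; exact (D.line_lt_line hl hsx).le) (by rwa [D.line_bot h1.lt])
    rw [max_eq_left hs.1] at hus
    rcases hu with ⟨hu | hu, hu'⟩
    · rcases hu' with hu' | hu'
      · exact h1.ne (hu.symm.trans hu')
      · exact hye (hu ▸ hu'.2)
    · rw [mem_singleton_iff.1 hu] at hus
      exact absurd hus hsx.not_ge
  · obtain ⟨u, hu, -⟩ := hg.exists_common hk (s := (D.pos y').2) (s' := (D.pos x').2)
      ⟨le_rfl, (l1.trans l2).le⟩ ⟨l1.le, l2.le⟩ ⟨lb, l1.le⟩ ⟨lb.trans l1.le, le_rfl⟩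
      (by rwa [hg.map_bot]) (by rw [hkx]; exact hfg.le)
    rcases hu with ⟨rfl | hu, rfl | hu'⟩
    · exact h.1.ne rfl
    · exact he.lt.not_ge (h.1.le.trans hu'.2)
    · exact hx'y hu.2
    · exact hye (hu.1.trans hu'.2)

theorem Left.isLeftmost_of_square [OrderBot L] {x x' y y' : L} (h : D.Left x y x') (h1 : y' ⋖ x')
    (h2 : y' ⋖ y) : IsLeftmost D.Left x' y' := by
  obtain ⟨-, h3⟩ := Left.isRightmost_of_square (D := D.mirror) (D.mirror_left.2 h) h1 h2
  exact ⟨h1, fun b hb hne => D.mirror_left.1 (h3 b hb hne)⟩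

end Planarity

end PlanarDiagram

/-! ### Upper covers in slim semimodular lattices -/

section Lattice

variable {L : Type*} [Lattice L]

/-- Betweenness in the dual diagram: the middle one of three upper covers lies below the join of the
outer two. -/
theorem le_of_covBy_of_sup_le [BoundedOrder L] [Finite L] (D : PlanarDiagram L) {w p q r : L}
    (hp : w ⋖ p) (hq : w ⋖ q) (hr : w ⋖ r) (hpq : p ≠ q) (hqr : q ≠ r) (hpr : p ≠ r) :
    p ≤ q ⊔ r ∨ q ≤ p ⊔ r ∨ r ≤ p ⊔ q := by
  have key {a b c : L} (h1 : D.dual.Left (.toDual w) (.toDual a) (.toDual b))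
      (h2 : D.dual.Left (.toDual w) (.toDual b) (.toDual c)) : b ≤ a ⊔ c :=
    h1.le_of_le_of_le h2 (OrderDual.toDual_le_toDual.2 (le_sup_left : a ≤ a ⊔ c))
      (OrderDual.toDual_le_toDual.2 le_sup_right)
  have tot {a b : L} (ha : w ⋖ a) (hb : w ⋖ b) (h : a ≠ b) :=
    D.dual.left_total ha.toDual hb.toDual (OrderDual.toDual.injective.ne h)
  rcases tot hp hq hpq with h1 | h1 <;> rcases tot hq hr hqr with h2 | h2 <;>
    rcases tot hp hr hpr with h3 | h3
  · exact .inr (.inl (key h1 h2))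
  · exact .inr (.inl (key h1 h2))
  · exact .inr (.inr (key h3 h2))
  · exact .inl (sup_comm r q ▸ key h3 h1)
  · exact .inl (key h1 h3)
  · exact .inr (.inr (sup_comm q p ▸ key h2 h3))
  · exact .inr (.inl (sup_comm r p ▸ key h2 h1))
  · exact .inr (.inl (sup_comm r p ▸ key h2 h1))

/-- In a slim planar semimodular lattice an element has at most two upper covers. -/
theorem IsSlim.eq_or_eq_of_covBy [BoundedOrder L] [Finite L] [IsUpperModularLattice L]
    (D : PlanarDiagram L) (hL : IsSlim L) {w p q r : L} (hp : w ⋖ p) (hq : w ⋖ q) (hr : w ⋖ r)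
    (hpq : p ≠ q) : r = p ∨ r = q := by
  by_contra! hne
  have key {a b c : L} (ha : w ⋖ a) (hb : w ⋖ b) (hc : w ⋖ c) (hab : a ≠ b) (hbc : b ≠ c)
      (hac : a ≠ c) (hle : b ≤ a ⊔ c) : False := by
    have inf {u v : L} (hu : w ⋖ u) (hv : w ⋖ v) (huv : u ≠ v) : u ⊓ v = w := by
      rcases hu.eq_or_eq (le_inf hu.le hv.le) inf_le_left with h | h
      · exact h
      · rcases hv.eq_or_eq hu.le (inf_eq_left.1 h) with h' | h'
        · exact absurd h' hu.ne'
        · exact absurd h' huv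
    have sup {u v : L} (hu : w ⋖ u) (hv : w ⋖ v) (huv : u ≠ v) : u ⋖ u ⊔ v :=
      covBy_sup_of_inf_covBy_right (by rwa [inf hu hv huv])
    -- By semimodularity `a ⊔ c` covers `a` and `c`, so `b ≤ a ⊔ c` makes all three joins equal and
    -- yields an M₃.
    refine hL ⟨w, a, b, c, a ⊔ c, hab, hbc, hac, inf ha hb hab, inf hb hc hbc, inf ha hc hac, ?_,
      ?_, rfl⟩
    · exact ((sup ha hc hac).eq_or_eq le_sup_left (sup_le le_sup_left hle)).resolve_left
        (sup ha hb hab).ne'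
    · rw [sup_comm b c, sup_comm a c] at *
      exact ((sup hc ha hac.symm).eq_or_eq le_sup_left (sup_le le_sup_left hle)).resolve_left
        (sup hc hb hbc.symm).ne'
  rcases le_of_covBy_of_sup_le D hp hq hr hpq hne.2.symm hne.1.symm with h | h | h
  · exact key hq hp hr hpq.symm hne.1.symm hne.2.symm h
  · exact key hp hq hr hpq hne.2.symm hne.1.symm h
  · exact key hp hr hq hne.1.symm hne.2 hpq h

end Lattice

/-! ### The edges subdivided by the fork, and perspectivities between prime intervals -/

namespace CoveringSquare

section Mirror

variable {L : Type*} [Lattice L] {D : PlanarDiagram L}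

/-- The covering square, in the reflected diagram. -/
def mirror (S : CoveringSquare D) : CoveringSquare D.mirror where
  o := S.o
  al := S.ar
  ar := S.al
  t := S.t
  o_covBy_al := S.o_covBy_ar
  o_covBy_ar := S.o_covBy_al
  al_covBy_t := S.ar_covBy_t
  ar_covBy_t := S.al_covBy_t
  left := D.mirror_left.2 S.left

variable {S : CoveringSquare D}

theorem mirror_leftEdge {y x : L} : S.mirror.LeftEdge y x ↔ S.RightEdge y x := by
  constructor
  · intro h
    induction h with
    | start => exact .start
    | step y x y' x' _ hl h1 h2 ih => exact .step y x y' x' ih (D.mirror_left.1 hl) h1 h2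
  · intro h
    induction h with
    | start => exact .start (S := S.mirror)
    | step y x y' x' _ hl h1 h2 ih => exact .step y x y' x' ih (D.mirror_left.2 hl) h1 h2

end Mirror

section Edges

variable {L : Type*} [Lattice L] {D : PlanarDiagram L} {S : CoveringSquare D}

theorem al_inf_ar (S : CoveringSquare D) : S.al ⊓ S.ar = S.o := by
  rcases S.o_covBy_al.eq_or_eq (le_inf S.o_covBy_al.le S.o_covBy_ar.le) inf_le_left with h | h
  · exact h
  · rcases S.o_covBy_ar.eq_or_eq S.o_covBy_al.le (inf_eq_left.1 h) with h' | h'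
    · exact absurd h' S.o_covBy_al.ne'
    · exact absurd h' S.left.ne

theorem LeftEdge.not_le_o {y x : L} (h : S.LeftEdge y x) : ¬ x ≤ S.o :=
  fun h' => h.spec.1.ne' ((inf_eq_left.2 h').symm.trans h.spec.2.2)

theorem LeftEdge.le_o {y x : L} (h : S.LeftEdge y x) : y ≤ S.o :=
  h.spec.2.2 ▸ inf_le_right

theorem LeftEdge.not_le_ar {y x : L} (h : S.LeftEdge y x) : ¬ x ≤ S.ar :=
  fun h' => h.not_le_o (S.al_inf_ar ▸ le_inf h.spec.2.1 h')

theorem LeftEdge.ar_sup {y x : L} (h : S.LeftEdge y x) : S.ar ⊔ x = S.t := by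
  rcases S.ar_covBy_t.eq_or_eq le_sup_left
    (sup_le S.ar_covBy_t.le (h.spec.2.1.trans S.al_covBy_t.le)) with h' | h'
  · exact absurd (sup_eq_left.1 h') h.not_le_ar
  · exact h'

theorem LeftEdge.not_t_le {y x : L} (h : S.LeftEdge y x) : ¬ S.t ≤ x :=
  fun h' => S.al_covBy_t.lt.not_ge (h'.trans h.spec.2.1)

theorem RightEdge.not_le_o {y x : L} (h : S.RightEdge y x) : ¬ x ≤ S.o :=
  (mirror_leftEdge.2 h).not_le_o

theorem RightEdge.le_o {y x : L} (h : S.RightEdge y x) : y ≤ S.o :=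
  (mirror_leftEdge.2 h).le_o

theorem RightEdge.not_le_al {y x : L} (h : S.RightEdge y x) : ¬ x ≤ S.al :=
  (mirror_leftEdge.2 h).not_le_ar

theorem RightEdge.al_sup {y x : L} (h : S.RightEdge y x) : S.al ⊔ x = S.t :=
  (mirror_leftEdge.2 h).ar_sup

theorem RightEdge.not_t_le {y x : L} (h : S.RightEdge y x) : ¬ S.t ≤ x :=
  (mirror_leftEdge.2 h).not_t_le

theorem LeftEdge.not_rightEdge {y x y' : L} (h : S.LeftEdge y x) : ¬ S.RightEdge y' x :=
  fun h' => h.not_le_ar h'.spec.2.1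

/-- Each left edge is the lower left side of a covering square: of `S` itself, or of the square that
produced it. -/
theorem LeftEdge.isRightmost [OrderBot L] [Finite L] {y x : L} (h : S.LeftEdge y x) :
    IsRightmost D.Left x y := by
  cases h with
  | start => exact S.left.isRightmost_of_square S.o_covBy_al S.o_covBy_ar
  | step y x y' x' _ hl h1 h2 => exact hl.isRightmost_of_square h1 h2

theorem RightEdge.isLeftmost [OrderBot L] [Finite L] {y x : L} (h : S.RightEdge y x) :
    IsLeftmost D.Left x y := by
  cases h with
  | start => exact S.left.isLeftmost_of_square S.o_covBy_ar S.o_covBy_al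
  | step y x y' x' _ hl h1 h2 => exact hl.isLeftmost_of_square h1 h2

variable [BoundedOrder L] [Finite L] [IsUpperModularLattice L]

/-- An element below the top of a left edge lies below the top of the next one, provided that it
is the top of a prime interval perspective to the edge. -/
theorem LeftEdge.exists_step (hL : IsSlim L) {y x d : L} (h : S.LeftEdge y x) (hdx : d < x)
    (hdy : ¬ d ≤ y) (hd : d ⊓ y ⋖ d) :
    ∃ y' x', D.Left x x' y ∧ y' ⋖ x' ∧ y' ⋖ y ∧ d ≤ x' := by
  obtain ⟨e₀, hde₀, he₀⟩ := exists_le_covBy_of_lt hdx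
  have hR := h.isRightmost
  have hleft {b : L} (hb : b ⋖ x) (hdb : d ≤ b) : D.Left x b y :=
    hR.2 b hb fun h' => hdy (h' ▸ hdb)
  -- the lower cover `e` of `x` next to `y` on the left
  obtain ⟨e, he, hmax⟩ := (Set.toFinite {b | D.Left x b y}).exists_maximalFor (D.slope x) _
    ⟨e₀, hleft he₀ hde₀⟩
  have hmax' {b : L} (hb : D.Left x b y) : b = e ∨ D.Left x b e := by
    by_contra! hne
    have h1 : D.Left x e b := (D.left_total he.1 hb.1 hne.1.symm).resolve_right hne.2
    exact (hmax hb h1.2.2.le).not_gt h1.2.2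
  have hye : ¬ y ≤ e := fun h' => by
    rcases he.2.1.eq_or_eq h' he.1.le with h3 | h3
    · exact he.ne h3
    · exact he.1.ne h3
  have hey : ¬ e ≤ y := fun h' => by
    rcases he.1.eq_or_eq h' he.2.1.le with h3 | h3
    · exact he.ne h3.symm
    · exact he.2.1.ne h3
  -- Nothing lies between `e` and `y`, so by betweenness `e` is above every common lower bound of
  -- `y` and another lower cover.
  have below {b w : L} (hb : D.Left x b y) (hwb : w ≤ b) (hwy : w ≤ y) : w ≤ e := by
    rcases hmax' hb with rfl | h1
    · exact hwb
    · exact h1.le_of_le_of_le he hwb hwy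
  obtain ⟨p, hwp, hpy⟩ := exists_covBy_le_of_lt (lt_of_le_not_ge (inf_le_right : e ⊓ y ≤ y)
    fun h' => hye (h'.trans inf_le_left))
  obtain ⟨q, hwq, hqe⟩ := exists_covBy_le_of_lt (lt_of_le_not_ge (inf_le_left : e ⊓ y ≤ e)
    fun h' => hey (h'.trans inf_le_right))
  have hpe : ¬ p ≤ e := fun h' => hwp.lt.not_ge (le_inf h' hpy)
  have hqy : ¬ q ≤ y := fun h' => hwq.lt.not_ge (le_inf hqe h')
  have hpq : p ⊓ q = e ⊓ y := le_antisymm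
    (le_inf (inf_le_right.trans hqe) (inf_le_left.trans hpy)) (le_inf hwp.le hwq.le)
  have hp : p ⋖ p ⊔ q := covBy_sup_of_inf_covBy_right (by rwa [hpq])
  have hq : q ⋖ p ⊔ q := covBy_sup_of_inf_covBy_left (by rwa [hpq])
  -- A lower cover `f` of `x` above `p ⊔ q` would be to the left of `y`, and `below` would give `p ≤
  -- e`. Once `p ⊔ q = x`, it follows that `p = y` and `q = e`, so `e` and `y` span a covering
  -- square.
  have hx : p ⊔ q = x := by
    by_contra hne
    obtain ⟨f, hf, hfx⟩ := exists_le_covBy_of_lt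
      (lt_of_le_of_ne (sup_le (hpy.trans he.2.1.le) (hqe.trans he.1.le)) hne)
    have hfy : f ≠ y := fun h' => hqy (h' ▸ le_sup_right.trans hf)
    exact hpe (below (hR.2 f hfx hfy) (le_sup_left.trans hf) hpy)
  rw [hx] at hp hq
  obtain rfl : p = y := ((hp.eq_or_eq hpy he.2.1.le).resolve_right he.2.1.ne).symm
  obtain rfl : q = e := ((hq.eq_or_eq hqe he.1.le).resolve_right he.1.ne).symm
  refine ⟨_, q, he, hwq, hwp, ?_⟩
  -- Otherwise the join of `d` with the bottom `q ⊓ p` of the square would be a third upper cover of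
  -- that bottom.
  by_contra hdq
  have hdw : ¬ d ≤ q ⊓ p := fun h' => hdq (h'.trans inf_le_left)
  have h1 : d ⊓ p ≤ q := below (hleft he₀ hde₀) (inf_le_left.trans hde₀) inf_le_right
  have h2 : d ⊓ (q ⊓ p) = d ⊓ p :=
    le_antisymm (inf_le_inf_left _ inf_le_right)
      (le_inf inf_le_left (le_inf h1 inf_le_right))
  have h3 : q ⊓ p ⋖ (q ⊓ p) ⊔ d := by
    rw [sup_comm]
    exact covBy_sup_of_inf_covBy_left (by rwa [h2])
  rcases hL.eq_or_eq_of_covBy D hwp hwq h3 he.ne.symm with h4 | h4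
  · exact hdy (h4 ▸ le_sup_right)
  · exact hdq (h4 ▸ le_sup_right)

/-- As long as `d` is strictly below the top of the edge, `exists_step` supplies the next edge,
still perspective to `[c, d]`; the descent stops when the top is `d`. -/
theorem LeftEdge.of_perspective (hL : IsSlim L) {y x c d : L} (h : S.LeftEdge y x) (hcd : c ⋖ d)
    (hx : x = y ⊔ d) (hc : c = y ⊓ d) : S.LeftEdge c d := by
  induction x using WellFoundedLT.induction generalizing y with
  | ind x ih =>
    have hdx : d ≤ x := hx ▸ le_sup_right
    have hdy : ¬ d ≤ y := fun h' => h.spec.1.ne' (hx.trans (sup_eq_left.2 h'))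
    rcases hdx.eq_or_lt with rfl | hlt
    · rwa [hc, inf_eq_left.2 h.spec.1.le]
    · obtain ⟨y', x', hl, h1, h2, hdx'⟩ := h.exists_step hL hlt hdy (by rwa [inf_comm, ← hc])
      have hy' : y' = x' ⊓ y := by
        rcases h1.eq_or_eq (le_inf h1.le h2.le) inf_le_left with h3 | h3
        · exact h3.symm
        · rcases hl.1.eq_or_eq (inf_eq_left.1 h3) hl.2.1.le with h4 | h4
          · exact absurd h4 hl.ne.symm
          · exact absurd h4 hl.2.1.ne
      have hdy' : ¬ d ≤ y' := fun h' => hdy (h'.trans h2.le)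
      refine ih x' hl.1.lt (.step _ _ _ _ h hl h1 h2) ?_ ?_
      · exact (((h1.eq_or_eq le_sup_left (sup_le h1.le hdx')).resolve_left
          fun h' => hdy' (sup_eq_left.1 h'))).symm
      · rw [hc, hy']
        exact le_antisymm (le_inf (le_inf (inf_le_right.trans hdx') inf_le_left) inf_le_right)
          (inf_le_inf_right _ inf_le_right)

/-- A prime interval down-perspective to a left edge is a left edge, or it is down-perspective
to `[ar, t]`. -/
theorem LeftEdge.of_perspective_up (hL : IsSlim L) {y x a b : L} (h : S.LeftEdge y x) (hab : a ⋖ b)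
    (hya : y ≤ a) (hxb : x ≤ b) (hxa : ¬ x ≤ a) : S.LeftEdge a b ∨ (S.ar ≤ a ∧ S.t ≤ b) := by
  -- Either `a` is the bottom of the edge, or `a` lies above the only upper cover `u` of that bottom
  -- that can be below `a`; this moves the perspectivity one edge up the chain, and at `[o, al]` out
  -- to `[ar, t]`.
  have other {y u : L} (hu : ∀ z, y ⋖ z → z ≤ a → z = u)
      (hya : y ≤ a) (hn : y = a → S.LeftEdge a b) : S.LeftEdge a b ∨ u ≤ a := by
    rcases hya.eq_or_lt with h0 | h0
    · exact .inl (hn h0)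
    · obtain ⟨z, hz, hza⟩ := exists_covBy_le_of_lt h0
      exact .inr (hu z hz hza ▸ hza)
  induction h with
  | start =>
    refine (other (u := S.ar) (fun z hz hza => ?_) hya ?_).imp_right
      fun h => ⟨h, ?_⟩
    · exact (hL.eq_or_eq_of_covBy D S.o_covBy_al S.o_covBy_ar hz S.left.ne).resolve_left
        fun h' => hxa (h' ▸ hza)
    · rintro rfl
      rw [← (hab.eq_or_eq S.o_covBy_al.le hxb).resolve_left fun h' => hxa h'.le]
      exact .start
    · rw [← (LeftEdge.start (S := S)).ar_sup]
      exact sup_le (h.trans hab.le) hxb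
  | step y x y' x' hyx hl h1 h2 ih =>
    have hya' : S.LeftEdge a b ∨ y ≤ a := by
      refine other (fun z hz hza => ?_) hya ?_
      · exact (hL.eq_or_eq_of_covBy D h1 h2 hz hl.ne).resolve_left fun h' => hxa (h' ▸ hza)
      · rintro rfl
        rw [← (hab.eq_or_eq h1.le hxb).resolve_left fun h' => hxa h'.le]
        exact .step _ _ _ _ hyx hl h1 h2
    refine hya'.elim .inl fun h => ?_
    have hx : x' ⊔ y = x := by
      rcases hl.1.eq_or_eq le_sup_left (sup_le hl.1.le hl.2.1.le) with h3 | h3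
      · rcases hl.2.1.eq_or_eq (sup_eq_left.1 h3) hl.1.le with h4 | h4
        · exact absurd h4 hl.ne
        · exact absurd h4 hl.1.ne
      · exact h3
    exact ih h (hx ▸ sup_le hxb (h.trans hab.le)) fun h' => hxa (hl.1.le.trans h')

theorem RightEdge.exists_step (hL : IsSlim L) {y x d : L} (h : S.RightEdge y x) (hdx : d < x)
    (hdy : ¬ d ≤ y) (hd : d ⊓ y ⋖ d) :
    ∃ y' x', D.Left x y x' ∧ y' ⋖ x' ∧ y' ⋖ y ∧ d ≤ x' := by
  obtain ⟨y', x', h1, h2⟩ := (mirror_leftEdge.2 h).exists_step hL hdx hdy hd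
  exact ⟨y', x', D.mirror_left.1 h1, h2⟩

theorem RightEdge.of_perspective (hL : IsSlim L) {y x c d : L} (h : S.RightEdge y x) (hcd : c ⋖ d)
    (hx : x = y ⊔ d) (hc : c = y ⊓ d) : S.RightEdge c d :=
  mirror_leftEdge.1 ((mirror_leftEdge.2 h).of_perspective hL hcd hx hc)

/-- A prime interval down-perspective to a right edge is a right edge, or it is down-perspective
to `[al, t]`. -/
theorem RightEdge.of_perspective_up (hL : IsSlim L) {y x a b : L} (h : S.RightEdge y x)
    (hab : a ⋖ b) (hya : y ≤ a) (hxb : x ≤ b) (hxa : ¬ x ≤ a) :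
    S.RightEdge a b ∨ (S.al ≤ a ∧ S.t ≤ b) :=
  ((mirror_leftEdge.2 h).of_perspective_up hL hab hya hxb hxa).imp_left mirror_leftEdge.1

end Edges

end CoveringSquare

/-- There is a sequence of down-perspectivities and swings from the prime interval `p` to the
interval `[a, b]`, which is prime. -/
def PrimeInterval.Reaches {L : Type*} [PartialOrder L] (left : L → L → L → Prop)
    (p : PrimeInterval L) (a b : L) : Prop :=
  ∃ h : a ⋖ b, Relation.ReflTransGen (fun r s => r.DownPersp s ∨ r.Swings left s) p ⟨a, b, h⟩

section Reaches

variable {L : Type*} [PartialOrder L] {left : L → L → L → Prop} {p : PrimeInterval L}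

theorem PrimeInterval.Reaches.persp {a b c d : L} (h : p.Reaches left a b) (hcd : c ⋖ d)
    (hb : IsLUB {a, d} b) (hc : IsGLB {a, d} c) : p.Reaches left c d :=
  ⟨hcd, h.2.tail (.inl ⟨hb, hc⟩)⟩

theorem PrimeInterval.Reaches.swing {a b c : L} (h : p.Reaches left a b) (hcb : c ⋖ b)
    (h3 : 3 ≤ {a : L | a ⋖ b}.encard) (hl : ¬ IsLeftmost left b c) (hr : ¬ IsRightmost left b c) :
    p.Reaches left c b :=
  ⟨hcb, h.2.tail (.inr ⟨rfl, h3, hl, hr⟩)⟩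

theorem isLUB_pair_of_forall {a b c : L} (ha : a ≤ c) (hb : b ≤ c)
    (h : ∀ d, a ≤ d → b ≤ d → c ≤ d) : IsLUB {a, b} c :=
  ⟨by simp [upperBounds, ha, hb], fun d hd => h d (hd (by simp)) (hd (by simp))⟩

theorem isGLB_pair_of_forall {a b c : L} (ha : c ≤ a) (hb : c ≤ b)
    (h : ∀ d, d ≤ a → d ≤ b → d ≤ c) : IsGLB {a, b} c :=
  ⟨by simp [lowerBounds, ha, hb], fun d hd => h d (hd (by simp)) (hd (by simp))⟩

end Reaches

/-! ### Coverings, joins and meets in the fork extension -/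

namespace CoveringSquare.Fork

variable {L : Type*} [Lattice L] {D : PlanarDiagram L} {S : CoveringSquare D}

section Order

theorem old_le_old {u v : L} : (old u : Fork S) ≤ old v ↔ u ≤ v := Iff.rfl

theorem old_lt_old {u v : L} : (old u : Fork S) < old v ↔ u < v := by
  rw [lt_iff_le_not_ge, lt_iff_le_not_ge, old_le_old, old_le_old]

theorem old_le_m {u : L} : (old u : Fork S) ≤ m ↔ u ≤ S.o := Iff.rfl

theorem m_le_old {v : L} : (m : Fork S) ≤ old v ↔ S.t ≤ v := Iff.rfl

theorem old_le_zl {u y x : L} {h : S.LeftEdge y x} : old u ≤ zl y x h ↔ u ≤ y := Iff.rfl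

theorem zl_le_old {u y x : L} {h : S.LeftEdge y x} : zl y x h ≤ old u ↔ x ≤ u := Iff.rfl

theorem zl_le_m {y x : L} {h : S.LeftEdge y x} : zl y x h ≤ m := trivial

theorem not_m_le_zl {y x : L} {h : S.LeftEdge y x} : ¬ m ≤ zl y x h := id

theorem zl_le_zl {y x y' x' : L} {h : S.LeftEdge y x} {h' : S.LeftEdge y' x'} :
    zl y x h ≤ zl y' x' h' ↔ y ≤ y' ∧ x ≤ x' := Iff.rfl

theorem old_le_zr {u y x : L} {h : S.RightEdge y x} : old u ≤ zr y x h ↔ u ≤ y := Iff.rfl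

theorem zr_le_old {u y x : L} {h : S.RightEdge y x} : zr y x h ≤ old u ↔ x ≤ u := Iff.rfl

theorem zr_le_m {y x : L} {h : S.RightEdge y x} : zr y x h ≤ m := trivial

theorem not_m_le_zr {y x : L} {h : S.RightEdge y x} : ¬ m ≤ zr y x h := id

theorem zr_le_zr {y x y' x' : L} {h : S.RightEdge y x} {h' : S.RightEdge y' x'} :
    zr y x h ≤ zr y' x' h' ↔ y ≤ y' ∧ x ≤ x' := Iff.rfl

theorem not_zl_le_zr {y x y' x' : L} {h : S.LeftEdge y x} {h' : S.RightEdge y' x'} :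
    ¬ zl y x h ≤ zr y' x' h' := id

theorem not_zr_le_zl {y x y' x' : L} {h : S.RightEdge y x} {h' : S.LeftEdge y' x'} :
    ¬ zr y x h ≤ zl y' x' h' := id

/-- The old elements below any element of `Fork S` form a principal ideal, and those above it a
principal filter, so joins and meets of K persist. -/
theorem isLUB_old {a b c : L} (h : c = a ⊔ b) : IsLUB {(old a : Fork S), old b} (old c) := by
  subst h
  refine isLUB_pair_of_forall (old_le_old.2 le_sup_left) (old_le_old.2 le_sup_right) ?_
  rintro (w | _ | ⟨y, x, h⟩ | ⟨y, x, h⟩) h1 h2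
  exacts [old_le_old.2 (sup_le h1 h2), old_le_m.2 (sup_le h1 h2), old_le_zl.2 (sup_le h1 h2),
    old_le_zr.2 (sup_le h1 h2)]

theorem isGLB_old {a b c : L} (h : c = a ⊓ b) : IsGLB {(old a : Fork S), old b} (old c) := by
  subst h
  refine isGLB_pair_of_forall (old_le_old.2 inf_le_left) (old_le_old.2 inf_le_right) ?_
  rintro (w | _ | ⟨y, x, h⟩ | ⟨y, x, h⟩) h1 h2
  exacts [old_le_old.2 (le_inf h1 h2), m_le_old.2 (le_inf h1 h2), zl_le_old.2 (le_inf h1 h2),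
    zr_le_old.2 (le_inf h1 h2)]

end Order

section Cover

theorem old_covBy_old {u v : L} (h : u ⋖ v) (hl : ¬ S.LeftEdge u v) (hr : ¬ S.RightEdge u v) :
    (old u : Fork S) ⋖ old v := by
  have key {y x : L} (hyx : y ⋖ x) (h1 : u ≤ y) (h2 : x ≤ v) : u = y ∧ v = x := by
    rcases h.eq_or_eq h1 (hyx.le.trans h2) with rfl | rfl
    · rcases h.eq_or_eq hyx.le h2 with rfl | rfl
      · exact absurd rfl hyx.ne
      · exact ⟨rfl, rfl⟩
    · exact absurd hyx.lt h2.not_gt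
  refine ⟨old_lt_old.2 h.lt, ?_⟩
  rintro (w | _ | ⟨y, x, hz⟩ | ⟨y, x, hz⟩) h1 h2
  · exact h.2 (old_lt_old.1 h1) (old_lt_old.1 h2)
  · have h1' : u ≤ S.o := h1.le
    have h2' : S.t ≤ v := h2.le
    exact h.2 (h1'.trans_lt S.o_covBy_al.lt) (S.al_covBy_t.lt.trans_le h2')
  · obtain ⟨rfl, rfl⟩ := key hz.spec.1 h1.le h2.le
    exact hl hz
  · obtain ⟨rfl, rfl⟩ := key hz.spec.1 h1.le h2.le
    exact hr hz

theorem covBy_of_old_covBy_old {u v : L} (h : (old u : Fork S) ⋖ old v) :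
    u ⋖ v ∧ ¬ S.LeftEdge u v ∧ ¬ S.RightEdge u v := by
  refine ⟨⟨old_lt_old.1 h.lt, fun w h1 h2 => h.2 (old_lt_old.2 h1) (old_lt_old.2 h2)⟩,
    fun hz => ?_, fun hz => ?_⟩
  · exact h.2 (c := zl u v hz) (lt_of_le_not_ge (old_le_zl.2 le_rfl) (hz.spec.1.lt.not_ge ·))
      (lt_of_le_not_ge (zl_le_old.2 le_rfl) (hz.spec.1.lt.not_ge ·))
  · exact h.2 (c := zr u v hz) (lt_of_le_not_ge (old_le_zr.2 le_rfl) (hz.spec.1.lt.not_ge ·))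
      (lt_of_le_not_ge (zr_le_old.2 le_rfl) (hz.spec.1.lt.not_ge ·))

theorem zl_covBy_old {y x : L} (h : S.LeftEdge y x) : zl y x h ⋖ old x := by
  refine ⟨lt_of_le_not_ge (zl_le_old.2 le_rfl) (h.spec.1.lt.not_ge ·), ?_⟩
  rintro (w | _ | ⟨y', x', h'⟩ | ⟨y', x', h'⟩) h1 h2
  · exact (old_lt_old.1 h2).not_ge h1.le
  · exact h.not_t_le h2.le
  · have e : x = x' := le_antisymm h1.le.2 h2.le
    subst e
    exact h1.not_ge ⟨(h'.spec.2.2.symm.trans h.spec.2.2).le, le_rfl⟩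
  · exact h1.le

theorem zr_covBy_old {y x : L} (h : S.RightEdge y x) : zr y x h ⋖ old x := by
  refine ⟨lt_of_le_not_ge (zr_le_old.2 le_rfl) (h.spec.1.lt.not_ge ·), ?_⟩
  rintro (w | _ | ⟨y', x', h'⟩ | ⟨y', x', h'⟩) h1 h2
  · exact (old_lt_old.1 h2).not_ge h1.le
  · exact h.not_t_le h2.le
  · exact h1.le
  · have e : x = x' := le_antisymm h1.le.2 h2.le
    subst e
    exact h1.not_ge ⟨(h'.spec.2.2.symm.trans h.spec.2.2).le, le_rfl⟩

theorem old_covBy_zl {y x : L} (h : S.LeftEdge y x) : old y ⋖ zl y x h := by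
  refine ⟨lt_of_le_not_ge (old_le_zl.2 le_rfl) (h.spec.1.lt.not_ge ·), ?_⟩
  rintro (w | _ | ⟨y', x', h'⟩ | ⟨y', x', h'⟩) h1 h2
  · exact (old_lt_old.1 h1).not_ge h2.le
  · exact h2.le
  · have e : y = y' := le_antisymm h1.le h2.le.1
    subst e
    have h3 : ¬ x ≤ x' := fun h3 => h2.not_ge ⟨le_rfl, h3⟩
    rcases h.spec.1.eq_or_eq h'.spec.1.le h2.le.2 with h4 | h4
    · exact h'.spec.1.ne' h4
    · exact h3 h4.ge
  · exact h2.le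

theorem old_covBy_zr {y x : L} (h : S.RightEdge y x) : old y ⋖ zr y x h := by
  refine ⟨lt_of_le_not_ge (old_le_zr.2 le_rfl) (h.spec.1.lt.not_ge ·), ?_⟩
  rintro (w | _ | ⟨y', x', h'⟩ | ⟨y', x', h'⟩) h1 h2
  · exact (old_lt_old.1 h1).not_ge h2.le
  · exact h2.le
  · exact h2.le
  · have e : y = y' := le_antisymm h1.le h2.le.1
    subst e
    have h3 : ¬ x ≤ x' := fun h3 => h2.not_ge ⟨le_rfl, h3⟩
    rcases h.spec.1.eq_or_eq h'.spec.1.le h2.le.2 with h4 | h4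
    · exact h'.spec.1.ne' h4
    · exact h3 h4.ge

theorem m_covBy_old : (m : Fork S) ⋖ old S.t := by
  have ht : ¬ S.t ≤ S.o := fun h => (S.o_covBy_al.lt.trans S.al_covBy_t.lt).not_ge h
  refine ⟨lt_of_le_not_ge (m_le_old.2 le_rfl) ht, ?_⟩
  rintro (w | _ | ⟨y', x', h'⟩ | ⟨y', x', h'⟩) h1 h2
  · exact (old_lt_old.1 h2).not_ge h1.le
  · exact h1.ne rfl
  · exact h1.le
  · exact h1.le

theorem al_covBy_old_t : (old S.al : Fork S) ⋖ old S.t :=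
  old_covBy_old S.al_covBy_t (fun h => h.not_t_le le_rfl) (fun h => h.not_t_le le_rfl)

theorem ar_covBy_old_t : (old S.ar : Fork S) ⋖ old S.t :=
  old_covBy_old S.ar_covBy_t (fun h => h.not_t_le le_rfl) (fun h => h.not_t_le le_rfl)

theorem eq_of_zl_covBy_old {y x v : L} {h : S.LeftEdge y x} (h' : zl y x h ⋖ old v) : v = x := by
  have hxv : x ≤ v := h'.le
  rcases hxv.eq_or_lt with h1 | h1
  · exact h1.symm
  · exact absurd (old_lt_old.2 h1) (h'.2 (zl_covBy_old h).lt)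

theorem eq_of_zr_covBy_old {y x v : L} {h : S.RightEdge y x} (h' : zr y x h ⋖ old v) : v = x := by
  have hxv : x ≤ v := h'.le
  rcases hxv.eq_or_lt with h1 | h1
  · exact h1.symm
  · exact absurd (old_lt_old.2 h1) (h'.2 (zr_covBy_old h).lt)

theorem eq_of_m_covBy_old {v : L} (h' : (m : Fork S) ⋖ old v) : v = S.t := by
  have hxv : S.t ≤ v := h'.le
  rcases hxv.eq_or_lt with h1 | h1
  · exact h1.symm
  · exact absurd (old_lt_old.2 h1) (h'.2 m_covBy_old.lt)

theorem eq_of_old_covBy_zl {y x u : L} {h : S.LeftEdge y x} (h' : old u ⋖ zl y x h) : u = y := by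
  have huy : u ≤ y := h'.le
  rcases huy.eq_or_lt with h1 | h1
  · exact h1
  · exact absurd (old_covBy_zl h).lt (h'.2 (old_lt_old.2 h1))

theorem eq_of_old_covBy_zr {y x u : L} {h : S.RightEdge y x} (h' : old u ⋖ zr y x h) : u = y := by
  have huy : u ≤ y := h'.le
  rcases huy.eq_or_lt with h1 | h1
  · exact h1
  · exact absurd (old_covBy_zr h).lt (h'.2 (old_lt_old.2 h1))

theorem not_old_covBy_m {u : L} : ¬ (old u : Fork S) ⋖ m := fun h => by
  have hu : u ≤ S.o := h.le
  refine h.2 (c := zl S.o S.al .start) (lt_of_le_not_ge hu ?_) (lt_of_le_not_ge trivial id)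
  exact fun h' => S.o_covBy_al.lt.not_ge (le_trans h' hu)

theorem zl_le_start {y x : L} (h : S.LeftEdge y x) : zl y x h ≤ zl S.o S.al .start :=
  ⟨h.le_o, h.spec.2.1⟩

theorem zr_le_start {y x : L} (h : S.RightEdge y x) : zr y x h ≤ zr S.o S.ar .start :=
  ⟨h.le_o, h.spec.2.1⟩

theorem eq_of_zl_covBy_m {y x : L} {h : S.LeftEdge y x} (h' : zl y x h ⋖ m) :
    zl y x h = zl S.o S.al .start := by
  by_contra hne
  exact h'.2 (lt_of_le_of_ne (zl_le_start h) hne) (lt_of_le_not_ge trivial id)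

theorem eq_of_zr_covBy_m {y x : L} {h : S.RightEdge y x} (h' : zr y x h ⋖ m) :
    zr y x h = zr S.o S.ar .start := by
  by_contra hne
  exact h'.2 (lt_of_le_of_ne (zr_le_start h) hne) (lt_of_le_not_ge trivial id)

end Cover

section Bounds

theorem isLUB_ar_zl {y x : L} (h : S.LeftEdge y x) : IsLUB {old S.ar, zl y x h} (old S.t) := by
  refine isLUB_pair_of_forall ar_covBy_old_t.le
    (zl_le_old.2 (h.spec.2.1.trans S.al_covBy_t.le)) ?_
  have hno : ¬ S.ar ≤ S.o := S.o_covBy_ar.lt.not_ge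
  rintro (w | _ | ⟨y', x', h'⟩ | ⟨y', x', h'⟩) h1 h2
  · exact old_le_old.2 (h.ar_sup ▸ sup_le h1 h2)
  · exact absurd h1 hno
  · exact absurd ((old_le_zl.1 h1).trans h'.le_o) hno
  · exact absurd ((old_le_zr.1 h1).trans h'.le_o) hno

theorem isGLB_ar_zl {y x : L} (h : S.LeftEdge y x) : IsGLB {old S.ar, zl y x h} (old y) := by
  refine isGLB_pair_of_forall (old_le_old.2 (h.le_o.trans S.o_covBy_ar.le))
    (old_le_zl.2 le_rfl) ?_
  rintro (w | _ | ⟨y', x', h'⟩ | ⟨y', x', h'⟩) h1 h2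
  · exact h2
  · exact absurd h2 not_m_le_zl
  · exact absurd h1 h'.not_le_ar
  · exact absurd h2 not_zr_le_zl

theorem isLUB_al_zr {y x : L} (h : S.RightEdge y x) : IsLUB {old S.al, zr y x h} (old S.t) := by
  refine isLUB_pair_of_forall al_covBy_old_t.le
    (zr_le_old.2 (h.spec.2.1.trans S.ar_covBy_t.le)) ?_
  have hno : ¬ S.al ≤ S.o := S.o_covBy_al.lt.not_ge
  rintro (w | _ | ⟨y', x', h'⟩ | ⟨y', x', h'⟩) h1 h2
  · exact old_le_old.2 (h.al_sup ▸ sup_le h1 h2)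
  · exact absurd h1 hno
  · exact absurd ((old_le_zl.1 h1).trans h'.le_o) hno
  · exact absurd ((old_le_zr.1 h1).trans h'.le_o) hno

theorem isGLB_al_zr {y x : L} (h : S.RightEdge y x) : IsGLB {old S.al, zr y x h} (old y) := by
  refine isGLB_pair_of_forall (old_le_old.2 (h.le_o.trans S.o_covBy_al.le))
    (old_le_zr.2 le_rfl) ?_
  rintro (w | _ | ⟨y', x', h'⟩ | ⟨y', x', h'⟩) h1 h2
  · exact h2
  · exact absurd h2 not_m_le_zr
  · exact absurd h2 not_zl_le_zr
  · exact absurd h1 h'.not_le_al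

theorem isLUB_m_old {x : L} (hx : x ≤ S.t) (hxo : ¬ x ≤ S.o) :
    IsLUB {(m : Fork S), old x} (old S.t) := by
  refine isLUB_pair_of_forall m_covBy_old.le (old_le_old.2 hx) ?_
  rintro (w | _ | ⟨y', x', h'⟩ | ⟨y', x', h'⟩) h1 h2
  · exact h1
  · exact absurd h2 hxo
  · exact absurd h1 id
  · exact absurd h1 id

/-- An old element below `m` and `x` is below `x ⊓ o = y`; a `zr` below `x ≤ al` is impossible. -/
theorem isGLB_m_zl {y x : L} (h : S.LeftEdge y x) : IsGLB {m, old x} (zl y x h) := by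
  refine isGLB_pair_of_forall zl_le_m (zl_le_old.2 le_rfl) ?_
  rintro (w | _ | ⟨y', x', h'⟩ | ⟨y', x', h'⟩) h1 h2
  · exact old_le_zl.2 (h.spec.2.2 ▸ le_inf h2 h1)
  · exact absurd h2 h.not_t_le
  · exact ⟨h.spec.2.2 ▸ le_inf (h'.spec.1.le.trans h2) h'.le_o, h2⟩
  · exact absurd ((zr_le_old.1 h2).trans h.spec.2.1) h'.not_le_al

theorem isGLB_m_zr {y x : L} (h : S.RightEdge y x) : IsGLB {m, old x} (zr y x h) := by
  refine isGLB_pair_of_forall zr_le_m (zr_le_old.2 le_rfl) ?_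
  rintro (w | _ | ⟨y', x', h'⟩ | ⟨y', x', h'⟩) h1 h2
  · exact old_le_zr.2 (h.spec.2.2 ▸ le_inf h2 h1)
  · exact absurd h2 h.not_t_le
  · exact absurd ((zl_le_old.1 h2).trans h.spec.2.1) h'.not_le_ar
  · exact ⟨h.spec.2.2 ▸ le_inf (h'.spec.1.le.trans h2) h'.le_o, h2⟩

variable [BoundedOrder L] [Finite L] [IsUpperModularLattice L]

/-- The edges `[z_{l,i+1}, z_{l,i}]` are down-perspective images of old prime intervals. -/
theorem exists_perspective_zl (hL : IsSlim L) {y x y' x' : L} {h : S.LeftEdge y x}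
    {h' : S.LeftEdge y' x'} (hc : zl y' x' h' ⋖ zl y x h) :
    ∃ w, w ⋖ x ∧ ¬ S.LeftEdge w x ∧ ¬ S.RightEdge w x ∧ IsLUB {old w, zl y x h} (old x) ∧
      IsGLB {old w, zl y x h} (zl y' x' h') := by
  have hx'x : x' < x := lt_of_le_of_ne hc.le.2 fun e => hc.lt.not_ge
    ⟨h.spec.2.2 ▸ h'.spec.2.2 ▸ e ▸ le_rfl, e.ge⟩
  have hx'y : ¬ x' ≤ y := fun h1 => h'.not_le_o (h1.trans h.le_o)
  have hinf : x' ⊓ y = y' := by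
    rw [← h.spec.2.2, ← inf_assoc, inf_eq_left.2 hx'x.le, h'.spec.2.2]
  obtain ⟨y₁, x₁, hl, h1, h2, hle⟩ := h.exists_step hL hx'x hx'y (hinf ▸ h'.spec.1)
  have hz := LeftEdge.step _ _ _ _ h hl h1 h2
  have hy₁ : x₁ ⊓ y = y₁ := by
    rw [← h.spec.2.2, ← inf_assoc, inf_eq_left.2 hl.1.le, hz.spec.2.2]
  -- The new element of the next edge lies weakly above `zl y' x' h'` and strictly below `zl y x h`,
  -- so the covering forces equality.
  have e : zl y' x' h' = zl y₁ x₁ hz := by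
    by_contra hne
    refine hc.2 (c := zl y₁ x₁ hz) (lt_of_le_of_ne ⟨?_, hle⟩ hne)
      (lt_of_le_not_ge ⟨h2.le, hl.1.le⟩ fun h3 => hl.1.lt.not_ge h3.2)
    rw [← hinf, ← hy₁]
    exact inf_le_inf_right _ hle
  rw [e]
  -- The old interval is `[x₁, x]`; it is not a left edge, since the right-most element below `x` is
  -- `y`.
  refine ⟨x₁, hl.1, fun h3 => hl.asymm (h3.isRightmost.2 y hl.2.1 hl.ne.symm), h.not_rightEdge,
    isLUB_pair_of_forall (old_le_old.2 hl.1.le) (zl_le_old.2 le_rfl) ?_,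
    isGLB_pair_of_forall (zl_le_old.2 le_rfl) (zl_le_zl.2 ⟨h2.le, hl.1.le⟩) ?_⟩
  · rintro (w | _ | ⟨y', x', h'⟩ | ⟨y', x', h'⟩) h3 h4
    · exact h4
    · exact absurd h3 hz.not_le_o
    · exact absurd ((old_le_zl.1 h3).trans h'.le_o) hz.not_le_o
    · exact absurd h4 not_zl_le_zr
  · rintro (w | _ | ⟨y', x', h'⟩ | ⟨y', x', h'⟩) h3 h4
    · exact old_le_zl.2 (hy₁ ▸ le_inf h3 h4)
    · exact absurd h4 not_m_le_zl
    · exact ⟨hy₁ ▸ le_inf (h'.spec.1.le.trans h3) h4.1, h3⟩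
    · exact absurd h4 not_zr_le_zl

/-- The edges `[z_{r,i+1}, z_{r,i}]` are down-perspective images of old prime intervals. -/
theorem exists_perspective_zr (hL : IsSlim L) {y x y' x' : L} {h : S.RightEdge y x}
    {h' : S.RightEdge y' x'} (hc : zr y' x' h' ⋖ zr y x h) :
    ∃ w, w ⋖ x ∧ ¬ S.LeftEdge w x ∧ ¬ S.RightEdge w x ∧ IsLUB {old w, zr y x h} (old x) ∧
      IsGLB {old w, zr y x h} (zr y' x' h') := by
  have hx'x : x' < x := lt_of_le_of_ne hc.le.2 fun e => hc.lt.not_ge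
    ⟨h.spec.2.2 ▸ h'.spec.2.2 ▸ e ▸ le_rfl, e.ge⟩
  have hx'y : ¬ x' ≤ y := fun h1 => h'.not_le_o (h1.trans h.le_o)
  have hinf : x' ⊓ y = y' := by
    rw [← h.spec.2.2, ← inf_assoc, inf_eq_left.2 hx'x.le, h'.spec.2.2]
  obtain ⟨y₁, x₁, hl, h1, h2, hle⟩ := h.exists_step hL hx'x hx'y (hinf ▸ h'.spec.1)
  have hz := RightEdge.step _ _ _ _ h hl h1 h2
  have hy₁ : x₁ ⊓ y = y₁ := by
    rw [← h.spec.2.2, ← inf_assoc, inf_eq_left.2 hl.2.1.le, hz.spec.2.2]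
  have e : zr y' x' h' = zr y₁ x₁ hz := by
    by_contra hne
    refine hc.2 (c := zr y₁ x₁ hz) (lt_of_le_of_ne ⟨?_, hle⟩ hne)
      (lt_of_le_not_ge ⟨h2.le, hl.2.1.le⟩ fun h3 => hl.2.1.lt.not_ge h3.2)
    rw [← hinf, ← hy₁]
    exact inf_le_inf_right _ hle
  rw [e]
  refine ⟨x₁, hl.2.1, fun h3 => h3.not_rightEdge h,
    fun h3 => hl.asymm (h3.isLeftmost.2 y hl.1 hl.ne),
    isLUB_pair_of_forall (old_le_old.2 hl.2.1.le) (zr_le_old.2 le_rfl) ?_,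
    isGLB_pair_of_forall (zr_le_old.2 le_rfl) (zr_le_zr.2 ⟨h2.le, hl.2.1.le⟩) ?_⟩
  · rintro (w | _ | ⟨y', x', h'⟩ | ⟨y', x', h'⟩) h3 h4
    · exact h4
    · exact absurd h3 hz.not_le_o
    · exact absurd h4 not_zr_le_zl
    · exact absurd ((old_le_zr.1 h3).trans h'.le_o) hz.not_le_o
  · rintro (w | _ | ⟨y', x', h'⟩ | ⟨y', x', h'⟩) h3 h4
    · exact old_le_zr.2 (hy₁ ▸ le_inf h3 h4)
    · exact absurd h4 not_m_le_zr
    · exact absurd h4 not_zl_le_zr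
    · exact ⟨hy₁ ▸ le_inf (h'.spec.1.le.trans h3) h4.1, h3⟩

end Bounds

end CoveringSquare.Fork

/-! ### Carrying step sequences from K over to K[S] -/

namespace CoveringSquare.Fork

open Set

variable {L : Type*} [Lattice L] {D : PlanarDiagram L} {S : CoveringSquare D}

section LowerCover

open Classical in
/-- The element covered by `old v` in `K[S]` that takes the place of the element `b` covered
by `v`. -/
noncomputable def lowerCover (S : CoveringSquare D) (v b : L) : Fork S :=
  if h : S.LeftEdge b v then zl b v h else if h : S.RightEdge b v then zr b v h else old b

theorem lowerCover_covBy {v b : L} (h : b ⋖ v) : lowerCover S v b ⋖ old v := by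
  unfold lowerCover
  split_ifs with h1 h2
  · exact zl_covBy_old h1
  · exact zr_covBy_old h2
  · exact old_covBy_old h h1 h2

theorem lowerCover_injective (v : L) : Function.Injective (lowerCover S v) := by
  intro b c h
  unfold lowerCover at h
  split_ifs at h <;> simp_all

theorem lowerCover_of_not_edge {v b : L} (hl : ¬ S.LeftEdge b v) (hr : ¬ S.RightEdge b v) :
    lowerCover S v b = old b := by
  simp [lowerCover, hl, hr]

theorem left_of_before_lowerCover {v b c : L} (h : Before (old v) (old b) (lowerCover S v c)) :
    D.Left v b c := by
  unfold lowerCover at h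
  split_ifs at h <;> exact h

theorem left_of_lowerCover_before {v b c : L} (h : Before (old v) (lowerCover S v c) (old b)) :
    D.Left v c b := by
  unfold lowerCover at h
  split_ifs at h <;> exact h

/-- `lowerCover` keeps the left-to-right order, so an old lower cover that is left-most in K[S] was
already left-most in K. -/
theorem not_isLeftmost_old {v c : L} (hc : c ⋖ v) (hl : ¬ S.LeftEdge c v)
    (hr : ¬ S.RightEdge c v) (h : ¬ IsLeftmost D.Left v c) :
    ¬ IsLeftmost (Left (S := S)) (old v) (old c) := fun h' =>
  h ⟨hc, fun _ hb hne => left_of_before_lowerCover (h'.2 _ (lowerCover_covBy hb) fun e =>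
    hne (lowerCover_injective v (e.trans (lowerCover_of_not_edge hl hr).symm))).2.2⟩

theorem not_isRightmost_old {v c : L} (hc : c ⋖ v) (hl : ¬ S.LeftEdge c v)
    (hr : ¬ S.RightEdge c v) (h : ¬ IsRightmost D.Left v c) :
    ¬ IsRightmost (Left (S := S)) (old v) (old c) := fun h' =>
  h ⟨hc, fun _ hb hne => left_of_lowerCover_before (h'.2 _ (lowerCover_covBy hb) fun e =>
    hne (lowerCover_injective v (e.trans (lowerCover_of_not_edge hl hr).symm))).2.2⟩

theorem three_le_encard_t : 3 ≤ {a : Fork S | a ⋖ old S.t}.encard := by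
  have h : ({old S.al, m, old S.ar} : Set (Fork S)).encard = 3 :=
    encard_eq_three.2 ⟨_, _, _, by simp, by simpa using S.left.ne, by simp, rfl⟩
  rw [← h]
  refine encard_le_encard ?_
  rintro _ (rfl | rfl | rfl)
  exacts [al_covBy_old_t, m_covBy_old, ar_covBy_old_t]

theorem isLeftmost_top [OrderTop L] {c : L} (h : IsLeftmost D.Left ⊤ c) :
    IsLeftmost (Left (S := S)) ⊤ (old c) := by
  have hS : S.al ≠ ⊤ := (S.al_covBy_t.lt.trans_le le_top).ne
  have hS' : S.ar ≠ ⊤ := (S.ar_covBy_t.lt.trans_le le_top).ne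
  have hc : (old c : Fork S) ⋖ old ⊤ := old_covBy_old h.1
    (fun h => hS (top_le_iff.1 h.spec.2.1)) (fun h => hS' (top_le_iff.1 h.spec.2.1))
  refine ⟨hc, fun b hb hne => ⟨hc, hb, ?_⟩⟩
  rcases b with b | _ | ⟨y, x, hz⟩ | ⟨y, x, hz⟩
  · exact h.2 b (covBy_of_old_covBy_old hb).1 fun e => hne (e ▸ rfl)
  · have ht := eq_of_m_covBy_old hb
    -- Being to the left of `m` means being to the left of `ar`; the left-most `c` is not `ar`,
    -- because `al` is to the left of `ar`.
    refine h.2 S.ar (ht ▸ S.ar_covBy_t) ?_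
    rintro rfl
    exact S.left.asymm (ht ▸ h.2 S.al (ht ▸ S.al_covBy_t) S.left.ne)
  · exact absurd (top_le_iff.1 (eq_of_zl_covBy_old hb ▸ hz.spec.2.1)) hS
  · exact absurd (top_le_iff.1 (eq_of_zr_covBy_old hb ▸ hz.spec.2.1)) hS'

theorem isRightmost_top [OrderTop L] {c : L} (h : IsRightmost D.Left ⊤ c) :
    IsRightmost (Left (S := S)) ⊤ (old c) := by
  have hS : S.al ≠ ⊤ := (S.al_covBy_t.lt.trans_le le_top).ne
  have hS' : S.ar ≠ ⊤ := (S.ar_covBy_t.lt.trans_le le_top).ne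
  have hc : (old c : Fork S) ⋖ old ⊤ := old_covBy_old h.1
    (fun h => hS (top_le_iff.1 h.spec.2.1)) (fun h => hS' (top_le_iff.1 h.spec.2.1))
  refine ⟨hc, fun b hb hne => ⟨hb, hc, ?_⟩⟩
  rcases b with b | _ | ⟨y, x, hz⟩ | ⟨y, x, hz⟩
  · exact h.2 b (covBy_of_old_covBy_old hb).1 fun e => hne (e ▸ rfl)
  · have ht := eq_of_m_covBy_old hb
    refine h.2 S.al (ht ▸ S.al_covBy_t) ?_
    rintro rfl
    exact S.left.asymm (ht ▸ h.2 S.ar (ht ▸ S.ar_covBy_t) S.left.ne.symm)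
  · exact absurd (top_le_iff.1 (eq_of_zl_covBy_old hb ▸ hz.spec.2.1)) hS
  · exact absurd (top_le_iff.1 (eq_of_zr_covBy_old hb ▸ hz.spec.2.1)) hS'

end LowerCover

section Reaches

variable {p : PrimeInterval (Fork S)}

theorem reaches_swing_old {a : Fork S} {x c : L} (h : p.Reaches Left a (old x)) (hc : c ⋖ x)
    (hcl : ¬ S.LeftEdge c x) (hcr : ¬ S.RightEdge c x) (h3 : 3 ≤ {a : L | a ⋖ x}.encard)
    (hl : ¬ IsLeftmost D.Left x c) (hr : ¬ IsRightmost D.Left x c) :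
    p.Reaches Left (old c) (old x) :=
  h.swing (old_covBy_old hc hcl hcr)
    (h3.trans (encard_le_encard_of_injOn (fun _ hb => lowerCover_covBy hb)
      (lowerCover_injective x).injOn))
    (not_isLeftmost_old hc hcl hcr hl) (not_isRightmost_old hc hcl hcr hr)

theorem reaches_m {a : Fork S} (h : p.Reaches Left a (old S.t)) :
    p.Reaches Left m (old S.t) :=
  h.swing m_covBy_old three_le_encard_t
    -- `m` to the left of `al` unfolds to `al` being to the left of itself; similarly for `ar`.
    (fun h => PlanarDiagram.Left.ne (h.2 (old S.al) al_covBy_old_t (by simp)).2.2 rfl)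
    fun h => PlanarDiagram.Left.ne (h.2 (old S.ar) ar_covBy_old_t (by simp)).2.2 rfl

theorem reaches_zl_upper {a : Fork S} (h : p.Reaches Left a (old S.t)) {y x : L}
    (hz : S.LeftEdge y x) : p.Reaches Left (zl y x hz) (old x) :=
  (reaches_m h).persp (zl_covBy_old hz)
    (isLUB_m_old (hz.spec.2.1.trans S.al_covBy_t.le) hz.not_le_o) (isGLB_m_zl hz)

theorem reaches_zr_upper {a : Fork S} (h : p.Reaches Left a (old S.t)) {y x : L}
    (hz : S.RightEdge y x) : p.Reaches Left (zr y x hz) (old x) :=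
  (reaches_m h).persp (zr_covBy_old hz)
    (isLUB_m_old (hz.spec.2.1.trans S.ar_covBy_t.le) hz.not_le_o) (isGLB_m_zr hz)

theorem reaches_zl_lower (h : p.Reaches Left (old S.ar) (old S.t)) {y x : L}
    (hz : S.LeftEdge y x) : p.Reaches Left (old y) (zl y x hz) :=
  h.persp (old_covBy_zl hz) (isLUB_ar_zl hz) (isGLB_ar_zl hz)

theorem reaches_zr_lower (h : p.Reaches Left (old S.al) (old S.t)) {y x : L}
    (hz : S.RightEdge y x) : p.Reaches Left (old y) (zr y x hz) :=
  h.persp (old_covBy_zr hz) (isLUB_al_zr hz) (isGLB_al_zr hz)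

theorem reaches_zl_m (h : p.Reaches Left (old S.al) (old S.t))
    (hc : zl S.o S.al .start ⋖ (m : Fork S)) : p.Reaches Left (zl S.o S.al .start) m :=
  h.persp hc (Set.pair_comm _ _ ▸ isLUB_m_old S.al_covBy_t.le S.o_covBy_al.lt.not_ge)
    (Set.pair_comm _ _ ▸ isGLB_m_zl .start)

theorem reaches_zr_m (h : p.Reaches Left (old S.ar) (old S.t))
    (hc : zr S.o S.ar .start ⋖ (m : Fork S)) : p.Reaches Left (zr S.o S.ar .start) m :=
  h.persp hc (Set.pair_comm _ _ ▸ isLUB_m_old S.ar_covBy_t.le S.o_covBy_ar.lt.not_ge)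
    (Set.pair_comm _ _ ▸ isGLB_m_zr .start)

/-- What a sequence of steps in `K` that ends with `[a, b]` yields in `K[S]`: if `[a, b]` is still
prime in `K[S]`, it is reached; otherwise the upper edge of `S` on the other side is reached. -/
structure Transfers (p : PrimeInterval (Fork S)) (a b : L) : Prop where
  old : ¬ S.LeftEdge a b → ¬ S.RightEdge a b → p.Reaches Left (old a) (old b)
  left : S.LeftEdge a b → p.Reaches Left (.old S.ar) (.old S.t)
  right : S.RightEdge a b → p.Reaches Left (.old S.al) (.old S.t)

theorem Transfers.exists_reaches {a b : L} (h : Transfers p a b) :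
    ∃ c, p.Reaches Left c (.old b) := by
  by_cases hl : S.LeftEdge a b
  · exact ⟨_, reaches_zl_upper (h.left hl) hl⟩
  · by_cases hr : S.RightEdge a b
    · exact ⟨_, reaches_zr_upper (h.right hr) hr⟩
    · exact ⟨_, h.old hl hr⟩

theorem reaches_of_le {a b c d : L} (h : p.Reaches Left (old a) (old b)) (hcd : c ⋖ d)
    (hl : ¬ S.LeftEdge c d) (hr : ¬ S.RightEdge c d) (hb : b = a ⊔ d) (hc : c = a ⊓ d) :
    p.Reaches Left (old c) (old d) :=
  h.persp (old_covBy_old hcd hl hr) (isLUB_old hb) (isGLB_old hc)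

theorem reaches_of_covBy {a b c d : L} (h : p.Reaches Left (old a) (old b)) (hcd : c ⋖ d)
    (hl : ¬ S.LeftEdge c d) (hr : ¬ S.RightEdge c d) (hca : c ≤ a) (hdb : d ≤ b)
    (hda : ¬ d ≤ a) : p.Reaches Left (old c) (old d) := by
  refine reaches_of_le h hcd hl hr ?_ ?_
  · rcases (covBy_of_old_covBy_old h.1).1.eq_or_eq le_sup_left
      (sup_le (covBy_of_old_covBy_old h.1).1.le hdb) with h' | h'
    · exact absurd (sup_eq_left.1 h') hda
    · exact h'.symm
  · rcases hcd.eq_or_eq (le_inf hca hcd.le) inf_le_right with h' | h'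
    · exact h'.symm
    · exact absurd (inf_eq_right.1 h') hda

/-- A swing depends on its source only through the top. If the source is an edge, its upper half
swings in its place; the target is no edge, its bottom being neither left-most nor right-most. -/
theorem Transfers.swings [OrderBot L] [Finite L] {q r : PrimeInterval L} (h : Transfers p q.bot q.top)
    (hqr : q.Swings D.Left r) : Transfers p r.bot r.top := by
  obtain ⟨h1, h3, hl, hr⟩ := hqr
  rw [h1] at h h3 hl hr
  obtain ⟨c, hc⟩ := h.exists_reaches
  exact ⟨fun hl' hr' => reaches_swing_old hc r.covBy hl' hr' h3 hl hr,
    fun h' => absurd h'.isRightmost hr, fun h' => absurd h'.isLeftmost hl⟩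

variable [BoundedOrder L] [Finite L] [IsUpperModularLattice L]

theorem Transfers.downPersp (hL : IsSlim L) {q r : PrimeInterval L} (h : Transfers p q.bot q.top)
    (hqr : q.DownPersp r) : Transfers p r.bot r.top := by
  obtain ⟨h1, h2⟩ := (q.downPersp_iff r).1 hqr
  have hra : ¬ r.top ≤ q.bot := fun h' => q.covBy.ne (h1.trans (sup_eq_left.2 h')).symm
  have hbq : r.bot ≤ q.bot := h2 ▸ inf_le_left
  have htq : r.top ≤ q.top := h1 ▸ le_sup_right
  by_cases hl : S.LeftEdge q.bot q.top
  · have hl' := hl.of_perspective hL r.covBy h1 h2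
    exact ⟨fun h' => absurd hl' h', fun _ => h.left hl, fun h' => absurd h' hl'.not_rightEdge⟩
  by_cases hr : S.RightEdge q.bot q.top
  · have hr' := hr.of_perspective hL r.covBy h1 h2
    exact ⟨fun _ h' => absurd hr' h', fun h' => absurd hr' h'.not_rightEdge, fun _ => h.right hr⟩
  have hq := h.old hl hr
  refine ⟨fun hl' hr' => reaches_of_le hq r.covBy hl' hr' h1 h2, fun hz => ?_, fun hz => ?_⟩
  -- The source is no edge but the target is a left edge, so the source is also down-perspective to
  -- `[ar, t]`.
  · obtain ⟨h3, h4⟩ := (hz.of_perspective_up hL q.covBy hbq htq hra).resolve_left hl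
    exact reaches_of_covBy hq S.ar_covBy_t (fun h => h.not_t_le le_rfl)
      (fun h => h.not_t_le le_rfl) h3 h4
      fun h5 => hra ((hz.spec.2.1.trans S.al_covBy_t.le).trans h5)
  · obtain ⟨h3, h4⟩ := (hz.of_perspective_up hL q.covBy hbq htq hra).resolve_left hr
    exact reaches_of_covBy hq S.al_covBy_t (fun h => h.not_t_le le_rfl)
      (fun h => h.not_t_le le_rfl) h3 h4
      fun h5 => hra ((hz.spec.2.1.trans S.ar_covBy_t.le).trans h5)

theorem Transfers.of_reflTransGen (hL : IsSlim L) {q r : PrimeInterval L}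
    (h : Transfers p q.bot q.top)
    (hqr : Relation.ReflTransGen (fun r s => r.DownPersp s ∨ r.Swings D.Left s) q r) :
    Transfers p r.bot r.top := by
  induction hqr with
  | refl => exact h
  | tail _ hs ih => exact hs.elim (ih.downPersp hL) ih.swings

/-- The prime intervals of K[S] are the unsubdivided old ones, `[m, t]`, the halves of the edges,
the two intervals below `m`, and the links of the two chains of new elements. Since `[o, al]` and
`[o, ar]` are edges, the invariant gives `[ar, t]` once `al ≤ c`, and `[al, t]` once `ar ≤ c`. -/
theorem reaches_of_top_le (hL : IsSlim L) {c : L}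
    (h : ∀ a b : L, a ⋖ b → b ≤ c → Transfers p a b) {a b : Fork S} (hab : a ⋖ b)
    (hb : b ≤ .old c) : p.Reaches Left a b := by
  have hl : S.al ≤ c → p.Reaches Left (old S.ar) (old S.t) := fun hc =>
    (h _ _ S.o_covBy_al hc).left .start
  have hr : S.ar ≤ c → p.Reaches Left (old S.al) (old S.t) := fun hc =>
    (h _ _ S.o_covBy_ar hc).right .start
  rcases b with v | _ | ⟨y, x, hz⟩ | ⟨y, x, hz⟩
  · replace hb : v ≤ c := hb
    rcases a with u | _ | ⟨y, x, hz⟩ | ⟨y, x, hz⟩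
    · obtain ⟨h1, h2, h3⟩ := covBy_of_old_covBy_old hab
      exact (h u v h1 hb).old h2 h3
    · obtain rfl := eq_of_m_covBy_old hab
      exact reaches_m (hl (S.al_covBy_t.le.trans hb))
    · obtain rfl := eq_of_zl_covBy_old hab
      exact reaches_zl_upper ((h _ _ hz.spec.1 hb).left hz) hz
    · obtain rfl := eq_of_zr_covBy_old hab
      exact reaches_zr_upper ((h _ _ hz.spec.1 hb).right hz) hz
  · replace hb : S.t ≤ c := hb
    rcases a with u | _ | ⟨y, x, hz⟩ | ⟨y, x, hz⟩
    · exact absurd hab not_old_covBy_m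
    · exact absurd rfl hab.ne
    · have e := eq_of_zl_covBy_m hab
      rw [e] at hab ⊢
      exact reaches_zl_m (hr (S.ar_covBy_t.le.trans hb)) hab
    · have e := eq_of_zr_covBy_m hab
      rw [e] at hab ⊢
      exact reaches_zr_m (hl (S.al_covBy_t.le.trans hb)) hab
  · replace hb : x ≤ c := hb
    rcases a with u | _ | ⟨y', x', hz'⟩ | ⟨y', x', hz'⟩
    · obtain rfl := eq_of_old_covBy_zl hab
      exact reaches_zl_lower ((h _ _ hz.spec.1 hb).left hz) hz
    · exact absurd hab.le not_m_le_zl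
    · obtain ⟨w, h1, h2, h3, h4, h5⟩ := exists_perspective_zl hL hab
      exact ((h w x h1 hb).old h2 h3).persp hab h4 h5
    · exact absurd hab.le not_zr_le_zl
  · replace hb : x ≤ c := hb
    rcases a with u | _ | ⟨y', x', hz'⟩ | ⟨y', x', hz'⟩
    · obtain rfl := eq_of_old_covBy_zr hab
      exact reaches_zr_lower ((h _ _ hz.spec.1 hb).right hz) hz
    · exact absurd hab.le not_m_le_zr
    · exact absurd hab.le not_zl_le_zr
    · obtain ⟨w, h1, h2, h3, h4, h5⟩ := exists_perspective_zr hL hab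
      exact ((h w x h1 hb).old h2 h3).persp hab h4 h5

end Reaches

end CoveringSquare.Fork

theorem lemma3p2 {K : Type*} [Lattice K] [BoundedOrder K] (D : PlanarDiagram K)
    (hK : IsSlimPatch D) (S : CoveringSquare D) (hSL : SL D.Left) :
    SL (CoveringSquare.Fork.Left (S := S)) := by
  have := hK.finite
  have := hK.semimodular
  obtain ⟨⟨cl, tl, hl⟩, ⟨cr, tr, hr⟩, hlt, hcl, hrt, hcr, h⟩ := hSL
  obtain rfl : tl = ⊤ := hlt
  obtain rfl : tr = ⊤ := hrt
  have hL := CoveringSquare.Fork.isLeftmost_top (S := S) hcl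
  have hR := CoveringSquare.Fork.isRightmost_top (S := S) hcr
  refine ⟨⟨.old cl, ⊤, hL.1⟩, ⟨.old cr, ⊤, hR.1⟩, rfl, hL, rfl, hR, fun q hq => ?_⟩
  -- The starting interval is no edge, because no edge has its top above `t`.
  have h0 : CoveringSquare.Fork.Transfers ⟨.old cl, ⊤, hL.1⟩ cl ⊤ :=
    ⟨fun _ _ => ⟨hL.1, .refl⟩, fun h' => absurd le_top h'.not_t_le,
      fun h' => absurd le_top h'.not_t_le⟩
  exact (CoveringSquare.Fork.reaches_of_top_le hK.slim
    (fun a b hab hb => h0.of_reflTransGen hK.slim (h ⟨a, b, hab⟩ hb)) q.covBy hq).2
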